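/- Let $\sigma_s>0$ and $0<\Delta<\sigma_s^2$, and put $\sigma_r^2=\sigma_s^2-\Delta$, $\alpha=\sigma_r^2/\sigma_s^2$ and $\tilde\sigma_\Delta^2=\sigma_r^2\Delta/\sigma_s^2$. Let $0<\beta'<\beta<\frac12$, and let $C\ge c>0$ be constants. There is an $N_0$, depending only on these data, such that the following holds for all $N=2^m\ge N_0$, all $r\in\mathbb N$ and all $\eta>0$ with $cN\le 1/\eta^2\le CN$ and $2^r\eta=\sqrt N$. **Test channel.** Let $X\sim D_{\eta\mathbb Z,\sigma_r}$, that is, $P(X=\lambda)\propto e^{-\lambda^2/(2\sigma_r^2)}$ for $\lambda\in\eta\mathbb Z$, and let $Y'=X+W$ with $W\sim\mathcal N(0,\Delta)$ independent of $X$. Let $X_1,\dots,X_r\in\{0,1\}$ be the bits with $X\in\eta\sum_{\ell=1}^r2^{\ell-1}X_\ell+2^r\eta\mathbb Z$. Take $N$ independent copies $X^{[N]},Y'^{[N]}$ and, over $\mathbb F_2$, let $U_\ell^{[N]}=X_\ell^{[N]}G_N$ with $G_N=\left[\begin{smallmatrix}1&0\\1&1\end{smallmatrix}\right]^{\otimes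 m}$. Denote by $P$ the resulting joint law. For a binary $V$ and any $S$ let $Z(V|S)=2\sum_s\sqrt{P_{V,S}(0,s)P_{V,S}(1,s)}$ be the Bhattacharyya parameter, with an integral of densities over the continuous part of $S$. The information and frozen sets of level $\ell$ are $$\mathcal I_\ell=\Big\{i\in[N]: Z\big(U_\ell^i\,\big|\,U_\ell^{1:i-1},X_{1:\ell-1}^{[N]},Y'^{[N]}\big)<1-2^{-N^\beta}\Big\},\qquad \mathcal F_\ell=[N]\setminus\mathcal I_\ell .$$ **Quantizer $\Lambda_Q$ with random shift.** Given $y^{[N]}\in\mathbb R^N$, the bits $u_\ell^i$ are determined successively for $\ell=1,\dots,r$ and $i=1,\dots,N$: if $i\in\mathcal I_\ell$, then $u_\ell^i=v$ with probability $P(U_\ell^i=v\mid u_\ell^{1:i-1},x_{1:\ell-1}^{[N]},y^{[N]})$, where $x_j^{[N]}=u_j^{[N]}G_N$; if $i\in\mathcal F_\ell$, then $u_\ell^i=\bar u_\ell^i$ is a pre-shared uniformly random bit, these bits being independent of each other and of the source. The reconstruction $x^{[N]}$ has as its $i$-th coordinate the point of the coset $\eta\sum_{\ell=1}^r2^{\ell-1}x_\ell^i+2^r\eta\mathbb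 Z$ nearest to $\alpha y^i$. **Claim.** Let $Y^{[N]}$ be an i.i.d. $\mathcal N(0,\sigma_s^2)$ source vector, $X^{[N]}$ its reconstruction by this quantizer, and $Q$ the joint law of $(X^{[N]},Y^{[N]})$ (averaged over the random shift). Then $\|\alpha Y^{[N]}-X^{[N]}\|^2$ is $Q$-integrable and $$\frac1N\,\mathsf E_Q\Big[\big\|\alpha Y^{[N]}-X^{[N]}\big\|^2\Big]\le\tilde\sigma_\Delta^2+2N\cdot2^{-N^{\beta'}} .$$ -/

import Mathlib

open MeasureTheory ProbabilityTheory

noncomputable section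

namespace PolarLattice

/-- The polar transform `G_N = [[1,0],[1,1]]^{⊗ m}` over `𝔽₂`, with `N = 2 ^ m`. -/
def polarG : (m : ℕ) → Matrix (Fin (2 ^ m)) (Fin (2 ^ m)) (ZMod 2)
  | 0 => 1
  | m + 1 =>
      Matrix.reindex (finProdFinEquiv.trans (finCongr (pow_succ' 2 m).symm))
        (finProdFinEquiv.trans (finCongr (pow_succ' 2 m).symm))
        (Matrix.kroneckerMap (fun a b => a * b)
          (!![1, 0; 1, 1] : Matrix (Fin 2) (Fin 2) (ZMod 2)) (polarG m))

/-- The variance `σ_r² = σ_s² - Δ` of the reconstruction. -/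
def recVar (σs Δ : ℝ) : ℝ := σs ^ 2 - Δ

/-- The MMSE scaling factor `α = σ_r² / σ_s²`. -/
def mmseScale (σs Δ : ℝ) : ℝ := recVar σs Δ / σs ^ 2

/-- The MMSE re-scaled noise variance `σ_r² Δ / σ_s²`. -/
def mmseVar (σs Δ : ℝ) : ℝ := recVar σs Δ * Δ / σs ^ 2

/-- The mass `D_{ηℤ, σ_r}(η k)` of the discrete Gaussian distribution on `ηℤ` centered at `0`,
with parameter `σ_r² = σ_s² - Δ`. -/
def latticeGaussian (η σs Δ : ℝ) (k : ℤ) : ℝ :=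
  gaussianPDFReal 0 (recVar σs Δ).toNNReal (η * k) /
    ∑' j : ℤ, gaussianPDFReal 0 (recVar σs Δ).toNNReal (η * j)

/-- An array of bits `x_ℓ^i`, for the levels `ℓ` (numbered from `0`) and the coordinates `i`.
Used both for the coset labels `x_{1:r}^{[N]}` and for their transforms `u_{1:r}^{[N]}`. -/
abbrev Bits (m r : ℕ) : Type := Fin r → Fin (2 ^ m) → ZMod 2

/-- The polar transform, applied at each level: the row vector `x_ℓ` is sent to `x_ℓ G_N`. -/
def transform {m r : ℕ} (x : Bits m r) : Bits m r :=
  fun ℓ => Matrix.vecMul (x ℓ) (polarG m)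

/-- The integer `∑_ℓ 2^ℓ b_ℓ` (levels numbered from `0`). The coset of `2^r η ℤ` in `η ℤ` which is
labelled by `b` is `η (∑_ℓ 2^ℓ b_ℓ) + 2^r η ℤ`. -/
def cosetLabel {r : ℕ} (b : Fin r → ZMod 2) : ℤ := ∑ ℓ : Fin r, 2 ^ (ℓ : ℕ) * ((b ℓ).val : ℤ)

/-- The joint density at `(b, y)` of the first `r` bits `X_{1:r}` of the lattice Gaussian input
`X ∼ D_{ηℤ, σ_r}` and of the output `Y' = X + W`, `W ∼ N(0, Δ)`, of the test channel:
the sum of `P_X(x) f_{Y'|X}(y|x)` over the points `x` of the coset labelled by `b`. -/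
def letterDensity {r : ℕ} (η σs Δ : ℝ) (b : Fin r → ZMod 2) (y : ℝ) : ℝ :=
  ∑' z : ℤ, latticeGaussian η σs Δ (cosetLabel b + 2 ^ r * z) *
    gaussianPDFReal (η * ((cosetLabel b + 2 ^ r * z : ℤ) : ℝ)) Δ.toNNReal y

/-- The joint density `P(x_{1:r}^{[N]}, y^{[N]})` for `N` independent uses of the test channel. -/
def blockDensity {m r : ℕ} (η σs Δ : ℝ) (x : Bits m r) (y : Fin (2 ^ m) → ℝ) : ℝ :=
  ∏ i, letterDensity η σs Δ (fun ℓ => x ℓ i) (y i)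

/-- The discrete data `(x_{1:ℓ-1}^{[N]}, u_ℓ^{1:i-1})` which precede `u_ℓ^i`. -/
abbrev Past (m r : ℕ) (ℓ : Fin r) (i : Fin (2 ^ m)) : Type :=
  ({j : Fin r // j < ℓ} → Fin (2 ^ m) → ZMod 2) × ({k : Fin (2 ^ m) // k < i} → ZMod 2)

/-- Reads off `(x_{1:ℓ-1}^{[N]}, u_ℓ^{1:i-1})` from `x` and `u`. -/
def past {m r : ℕ} (ℓ : Fin r) (i : Fin (2 ^ m)) (x u : Bits m r) : Past m r ℓ i :=
  (fun j => x j, fun k => u ℓ k)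

/-- The joint density of `(U_ℓ^i, X_{1:ℓ-1}^{[N]}, U_ℓ^{1:i-1}, Y'^{[N]})` at `(v, s, y)`, where
`U_ℓ^{[N]} = X_ℓ^{[N]} G_N`. -/
def bitDensity {m r : ℕ} (η σs Δ : ℝ) (ℓ : Fin r) (i : Fin (2 ^ m)) (v : ZMod 2)
    (s : Past m r ℓ i) (y : Fin (2 ^ m) → ℝ) : ℝ :=
  ∑ x : Bits m r with past ℓ i x (transform x) = s ∧ transform x ℓ i = v,
    blockDensity η σs Δ x y

/-- The conditional probability `P(v | u_ℓ^{1:i-1}, x_{1:ℓ-1}^{[N]}, y^{[N]})` of `U_ℓ^i = v`. -/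
def bitCond {m r : ℕ} (η σs Δ : ℝ) (ℓ : Fin r) (i : Fin (2 ^ m)) (v : ZMod 2)
    (s : Past m r ℓ i) (y : Fin (2 ^ m) → ℝ) : ℝ :=
  bitDensity η σs Δ ℓ i v s y / (bitDensity η σs Δ ℓ i 0 s y + bitDensity η σs Δ ℓ i 1 s y)

/-- The Bhattacharyya parameter `Z(U_ℓ^i | U_ℓ^{1:i-1}, X_{1:ℓ-1}^{[N]}, Y'^{[N]})`. -/
def bhattacharyya {m r : ℕ} (η σs Δ : ℝ) (ℓ : Fin r) (i : Fin (2 ^ m)) : ℝ :=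
  2 * ∑ s : Past m r ℓ i, ∫ y : Fin (2 ^ m) → ℝ,
    √(bitDensity η σs Δ ℓ i 0 s y * bitDensity η σs Δ ℓ i 1 s y)

/-- The information set of level `ℓ`. Its complement is the frozen set. -/
def infoSet {m r : ℕ} (η σs Δ β : ℝ) (ℓ : Fin r) : Set (Fin (2 ^ m)) :=
  {i | bhattacharyya η σs Δ ℓ i < 1 - (2 : ℝ) ^ (-((2 : ℝ) ^ m) ^ β)}

open Classical in
/-- The probability that the quantizer, with pre-shared frozen bits `ubar`, chooses the bits
`u_{1:r}^{[N]}` for the source realization `y`: level by level, and with increasing `i` in each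
level, the bit `u_ℓ^i` is drawn from `P(· | u_ℓ^{1:i-1}, x_{1:ℓ-1}^{[N]}, y^{[N]})` if `i` is in
the information set, and it is the pre-shared bit otherwise. Here `x_ℓ = u_ℓ G_N`. -/
def quantizerProb {m r : ℕ} (η σs Δ β : ℝ) (ubar u : Bits m r) (y : Fin (2 ^ m) → ℝ) : ℝ :=
  ∏ ℓ, ∏ i,
    if i ∈ infoSet η σs Δ β ℓ then bitCond η σs Δ ℓ i (u ℓ i) (past ℓ i (transform u) u) y
    else if u ℓ i = ubar ℓ i then 1 else 0

/-- The reconstruction `x^{[N]}` from `u_{1:r}^{[N]}` and `y^{[N]}`: in each coordinate the first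
`r` levels determine a coset `a + 2^r η ℤ`, and the remaining levels are determined by rounding,
so that the result is the point of this coset which is nearest to `α y^i`. -/
def reconstruct {m r : ℕ} (η σs Δ : ℝ) (u : Bits m r) (y : Fin (2 ^ m) → ℝ) :
    Fin (2 ^ m) → ℝ :=
  fun i =>
    let a : ℝ := η * cosetLabel (fun ℓ => transform u ℓ i)
    a + 2 ^ r * η * round ((mmseScale σs Δ * y i - a) / (2 ^ r * η))

theorem measurable_quantizerProb {m r : ℕ} (η σs Δ β : ℝ) (ubar u : Bits m r) :
    Measurable (quantizerProb η σs Δ β ubar u) := by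
  have h1 : ∀ b : Fin r → ZMod 2, Measurable (letterDensity η σs Δ b) := fun b => by
    unfold letterDensity
    refine Measurable.tsum (fun z => ?_)
    exact (measurable_gaussianPDFReal _ _).const_mul _
  have h2 : ∀ x : Bits m r, Measurable (blockDensity η σs Δ x) := fun x => by
    unfold blockDensity
    exact Finset.measurable_prod _ fun i _ => (h1 _).comp (measurable_pi_apply i)
  have h3 : ∀ ℓ i v s, Measurable (bitDensity (m := m) (r := r) η σs Δ ℓ i v s) := by
    intro ℓ i v s
    unfold bitDensity
    exact Finset.measurable_sum _ fun x _ => h2 x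
  unfold quantizerProb
  refine Finset.measurable_prod _ fun ℓ _ => Finset.measurable_prod _ fun i _ => ?_
  split_ifs
  · exact (h3 _ _ _ _).div ((h3 _ _ _ _).add (h3 _ _ _ _))
  all_goals exact measurable_const

theorem measurable_reconstruct {m r : ℕ} (η σs Δ : ℝ) (u : Bits m r) :
    Measurable (reconstruct η σs Δ u) := by
  unfold reconstruct
  refine measurable_pi_lambda _ fun i => ?_
  have : Measurable (fun x : ℝ => ((round x : ℤ) : ℝ)) := by
    simp_rw [round_eq]
    exact (measurable_from_top (f := fun z : ℤ => (z:ℝ))).comp (Int.measurable_floor.comp (measurable_id.add_const _))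
  exact measurable_const.add (measurable_const.mul (this.comp ((((measurable_pi_apply i).const_mul _).sub_const _).div_const _)))

/-- The law of the i.i.d. Gaussian source vector, with mean `0` and variance `σ_s²`. -/
def source (m : ℕ) (σs : ℝ) : Measure (Fin (2 ^ m) → ℝ) :=
  Measure.pi fun _ => gaussianReal 0 (σs ^ 2).toNNReal

/-- The joint law `Q` of the reconstruction `X^{[N]}` (first component) and of the Gaussian source
vector `Y^{[N]}` (second component), when the pre-shared frozen bits are uniformly random and
independent of the source. -/
def jointLaw (m r : ℕ) (η σs Δ β : ℝ) :
    Measure ((Fin (2 ^ m) → ℝ) × (Fin (2 ^ m) → ℝ)) :=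
  ∑ ubar : Bits m r, ∑ u : Bits m r,
    (Fintype.card (Bits m r) : ENNReal)⁻¹ •
      ((source m σs).withDensity
        (fun y => ENNReal.ofReal (quantizerProb η σs Δ β ubar u y))).map
          (fun y => (reconstruct η σs Δ u y, y))

/-- The quadratic distortion `‖α y - x‖²` (Euclidean norm) of a pair `(x, y)`. -/
def distortion {m : ℕ} (σs Δ : ℝ) (p : (Fin (2 ^ m) → ℝ) × (Fin (2 ^ m) → ℝ)) : ℝ :=
  ∑ i, (mmseScale σs Δ * p.2 i - p.1 i) ^ 2

end PolarLattice

end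

/-!
The distortion bound does not depend on polarization: the frozen bits, however many there are, may
be replaced by uniformly random ones, because a Bhattacharyya parameter of at least `1 - δ` forces
a bit to be nearly uniform given its past.

Fix a source realization `y`. Let `g` be the source density, `p(u)` the joint density of the bits
`u` and of the test channel output at `y`, `f = ∑ p(u)` the output density, `q(u)` the probability
that the quantizer chooses `u`, averaged over the frozen bits, and `D(u)` the distortion. Then
`∑ g q D = ∑ p D + (g - f) ∑ q D + ∑ (f q - p) D`, and the three terms are bounded as follows
(`distortion_pointwise_le`, `lintegral_distortion_le`).

* The integral of `∑ p D` is at most `N σ̃_Δ²`. The channel input is a point of the coset which its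
  bits label, so that rounding `α y` to this coset is no worse than choosing the input itself, and
  the error `α Y' - X` of the input has second moment `(1 - α)² E X² + α² Δ`
  (`integral_cellError_le`). Here `E X² ≤ σ_r²`, which is a consequence of the functional equation
  of the theta series (`tsum_sq_mul_exp_le`).
* Rounding to a coset of `2 ^ r η ℤ` makes an error of at most `2 ^ r η / 2 = √N / 2` in each
  coordinate, so `D ≤ N² / 4`. By Poisson summation, `f ≥ (1 - N ε) g` where `ε` is exponentially
  small in `1 / η²` (`one_sub_flatness_mul_le`, `flatness_le`), and this bounds the second term.
* For the third term, the quantities `f q` and `p` are connected by joint laws in which the bits up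
  to some position are drawn correctly and the later ones as the quantizer does
  (`sum_abs_hybrid_sub_le`). Only the frozen positions contribute, and each of these contributes the
  `L¹` distance between the joint densities of the past with the bit `0` and with the bit `1`, which
  is at most `√(2 δ)` with `δ = 2 ^ (-N ^ β)` (`integral_abs_bitDensity_le`).

There are at most `r N` frozen bits and `r ≤ 2 ^ r = √N / η` is of order `N`, so the last two terms
are a polynomial in `N` times `exp (-a N)` and `2 ^ (-N ^ β / 2)`, for some `a > 0`; since
`β' < β < 1`, both are eventually smaller than `2 ^ (-N ^ β')` (`exists_threshold`).
-/

noncomputable section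

namespace PolarLattice

/-! ### Theta series and Poisson summation -/

open Real in
/-- The theta series `θ(t) = ∑ₙ exp(-π t n²)`. -/
def theta (t : ℝ) : ℝ := ∑' n : ℤ, Real.exp (-π * t * (n : ℝ) ^ 2)

section Theta
open Real

theorem summable_pow_mul_exp_neg_sq {t : ℝ} (ht : 0 < t) (k : ℕ) :
    Summable fun n : ℤ => |(n : ℝ)| ^ k * Real.exp (-π * t * (n : ℝ) ^ 2) := by
  have := summable_pow_mul_jacobiTheta₂_term_bound 0 ht k
  refine this.congr fun n => ?_
  simp only [mul_zero, zero_mul, sub_zero, mul_assoc, Int.cast_abs]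

theorem summable_exp_neg_sq {t : ℝ} (ht : 0 < t) :
    Summable fun n : ℤ => Real.exp (-π * t * (n : ℝ) ^ 2) := by
  simpa using summable_pow_mul_exp_neg_sq ht 0

theorem summable_sq_mul_exp_neg_sq {t : ℝ} (ht : 0 < t) :
    Summable fun n : ℤ => (n : ℝ) ^ 2 * Real.exp (-π * t * (n : ℝ) ^ 2) := by
  simpa using summable_pow_mul_exp_neg_sq ht 2

theorem theta_eq_one_add {t : ℝ} (ht : 0 < t) :
    theta t = 1 + ∑' n : ℤ, if n = 0 then 0 else Real.exp (-π * t * (n : ℝ) ^ 2) := by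
  have := (summable_exp_neg_sq ht).tsum_eq_add_tsum_ite 0
  simpa [theta] using this

theorem one_le_theta {t : ℝ} (ht : 0 < t) : 1 ≤ theta t := by
  rw [theta_eq_one_add ht]
  have : 0 ≤ ∑' n : ℤ, if n = 0 then 0 else Real.exp (-π * t * (n : ℝ) ^ 2) :=
    tsum_nonneg fun n => by split_ifs <;> positivity
  linarith

theorem theta_antitone {s t : ℝ} (hs : 0 < s) (hst : s ≤ t) : theta t ≤ theta s := by
  refine (summable_exp_neg_sq (hs.trans_le hst)).tsum_le_tsum (fun n => ?_)
    (summable_exp_neg_sq hs)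
  apply Real.exp_le_exp.2
  have : s * (n : ℝ) ^ 2 ≤ t * (n : ℝ) ^ 2 := by gcongr
  nlinarith [pi_pos]

theorem theta_sub_one_le {t : ℝ} (ht : 1 ≤ t) :
    theta t - 1 ≤ Real.exp (-π * (t - 1)) * (theta 1 - 1) := by
  have ht0 : 0 < t := by linarith
  rw [theta_eq_one_add ht0, theta_eq_one_add one_pos, add_sub_cancel_left, add_sub_cancel_left,
    ← tsum_mul_left]
  have hs : ∀ {t : ℝ}, 0 < t →
      Summable fun n : ℤ => if n = 0 then (0 : ℝ) else Real.exp (-π * t * (n : ℝ) ^ 2) :=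
    fun {t} ht => (summable_exp_neg_sq ht).of_nonneg_of_le
      (fun n => by split_ifs <;> positivity) (fun n => by split_ifs <;> first | positivity | rfl)
  refine (hs ht0).tsum_le_tsum (fun n => ?_) ((hs one_pos).mul_left _)
  split_ifs with h
  · simp
  · rw [← Real.exp_add]
    apply Real.exp_le_exp.2
    have h1 : (1 : ℝ) ≤ (n : ℝ) ^ 2 := by
      have : (1 : ℤ) ≤ n ^ 2 := by have := sq_pos_of_ne_zero h; omega
      exact_mod_cast this
    nlinarith [mul_nonneg (mul_nonneg pi_pos.le (sub_nonneg.2 ht)) (sub_nonneg.2 h1)]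

/-- The functional equation of the theta series. -/
theorem theta_inv {t : ℝ} (ht : 0 < t) : theta t⁻¹ = √t * theta t := by
  have h := Real.tsum_exp_neg_mul_int_sq ht
  have h2 : theta t⁻¹ = ∑' n : ℤ, Real.exp (-π / t * (n : ℝ) ^ 2) := by
    simp only [theta, div_eq_mul_inv]
  rw [h2, theta, h, sqrt_eq_rpow]
  field_simp

/-- A Poisson summation bound: the Gaussian sum over a shifted lattice is almost as large as the
Gaussian integral, uniformly in the shift. -/
theorem sqrt_mul_le_tsum_exp_shift {t : ℝ} (ht : 0 < t) (x : ℝ) :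
    √t * (2 - theta t) ≤ ∑' n : ℤ, Real.exp (-π / t * ((n : ℝ) + x) ^ 2) := by
  have hre : 0 < (t : ℂ).re := by simpa
  have h := Complex.tsum_exp_neg_quadratic hre (-Complex.I * x)
  have e1 : (∑' n : ℤ, Complex.exp (-π / (t : ℂ) * (n + Complex.I * (-Complex.I * x)) ^ 2)) =
      ((∑' n : ℤ, Real.exp (-π / t * ((n : ℝ) + x) ^ 2) : ℝ) : ℂ) := by
    rw [Complex.ofReal_tsum]
    refine tsum_congr fun n => ?_
    push_cast
    congr 3
    rw [← mul_assoc, mul_neg, Complex.I_mul_I]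
    ring
  have e2 : (t : ℂ) ^ (1 / 2 : ℂ) = ((√t : ℝ) : ℂ) := by
    rw [sqrt_eq_rpow, Complex.ofReal_cpow ht.le]; norm_num
  set c : ℤ → ℂ := fun n => Complex.exp (-π * t * n ^ 2 + 2 * π * (-Complex.I * x) * n) with hc
  have hnorm : ∀ n, ‖c n‖ = Real.exp (-π * t * (n : ℝ) ^ 2) := fun n => by
    rw [hc, Complex.norm_exp]
    congr 1
    have : (-π * t * n ^ 2 + 2 * π * (-Complex.I * x) * n : ℂ) =
      ((-π * t * (n : ℝ) ^ 2 : ℝ) : ℂ) + ((-2 * π * x * n : ℝ) : ℂ) * Complex.I := by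
      push_cast; ring
    rw [this, Complex.add_re, Complex.ofReal_re, Complex.re_ofReal_mul, Complex.I_re]
    ring
  have hsum : Summable c := by
    apply Summable.of_norm
    simpa only [hnorm] using summable_exp_neg_sq ht
  have hs' : Summable fun n : ℤ => if n = 0 then (0 : ℝ) else Real.exp (-π * t * (n : ℝ) ^ 2) :=
    (summable_exp_neg_sq ht).of_nonneg_of_le
      (fun n => by split_ifs <;> positivity) (fun n => by split_ifs <;> first | positivity | rfl)
  have h3 : ∑' n, c n = 1 + ∑' n, if n = 0 then 0 else c n := by
    have := hsum.tsum_eq_add_tsum_ite 0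
    simpa [hc] using this
  have h4 : ‖∑' n, if n = 0 then 0 else c n‖ ≤ theta t - 1 := by
    rw [theta_eq_one_add ht, add_sub_cancel_left]
    refine tsum_of_norm_bounded hs'.hasSum fun n => ?_
    split_ifs
    · simp
    · exact (hnorm n).le
  rw [e1, e2, h3] at h
  have hst : (0 : ℝ) < √t := sqrt_pos.2 ht
  have h5 : ((∑' n : ℤ, Real.exp (-π / t * ((n : ℝ) + x) ^ 2) : ℝ) : ℂ) =
      ((√t : ℝ) : ℂ) * (1 + ∑' n, if n = 0 then 0 else c n) := by
    rw [h]
    have : ((√t : ℝ) : ℂ) ≠ 0 := by exact_mod_cast hst.ne'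
    field_simp
  have h6 := congrArg Complex.re h5
  rw [Complex.ofReal_re, Complex.re_ofReal_mul] at h6
  rw [h6]
  refine mul_le_mul_of_nonneg_left ?_ hst.le
  have := (Complex.abs_re_le_norm _).trans h4
  have := (abs_le.1 this).1
  simp only [Complex.add_re, Complex.one_re]
  linarith

/-- The second moment of the theta series. By the functional equation `√t θ(t) = θ(1/t)` is
nondecreasing in `t`, and the bound says that its logarithmic derivative is nonnegative; it is
obtained from difference quotients, using the convexity of the exponential function. -/
theorem tsum_sq_mul_exp_le {t : ℝ} (ht : 0 < t) :
    2 * π * t * ∑' n : ℤ, (n : ℝ) ^ 2 * Real.exp (-π * t * (n : ℝ) ^ 2) ≤ theta t := by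
  set M := ∑' n : ℤ, (n : ℝ) ^ 2 * Real.exp (-π * t * (n : ℝ) ^ 2) with hM
  have key : ∀ s, 0 < s → s < t → π * M * (√s * (√t + √s)) ≤ theta t := by
    intro s hs hst
    have h1 : theta t + π * (t - s) * M ≤ theta s := by
      rw [hM, ← tsum_mul_left, theta,
        ← (summable_exp_neg_sq ht).tsum_add ((summable_sq_mul_exp_neg_sq ht).mul_left _)]
      refine ((summable_exp_neg_sq ht).add
        ((summable_sq_mul_exp_neg_sq ht).mul_left _)).tsum_le_tsum (fun n => ?_)
        (summable_exp_neg_sq hs)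
      have e : Real.exp (-π * s * (n : ℝ) ^ 2) =
          Real.exp (-π * t * (n : ℝ) ^ 2) * Real.exp (π * (t - s) * (n : ℝ) ^ 2) := by
        rw [← Real.exp_add]; congr 1; ring
      rw [e]
      have := Real.add_one_le_exp (π * (t - s) * (n : ℝ) ^ 2)
      have h0 := Real.exp_pos (-π * t * (n : ℝ) ^ 2)
      nlinarith
    have h2 : √s * theta s ≤ √t * theta t := by
      rw [← theta_inv hs, ← theta_inv ht]
      exact theta_antitone (inv_pos.2 ht) (inv_anti₀ hs hst.le)
    have hlt : √s < √t := sqrt_lt_sqrt hs.le hst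
    have hss : 0 < √s := sqrt_pos.2 hs
    have h3 : √s * (theta t + π * (t - s) * M) ≤ √t * theta t :=
      (mul_le_mul_of_nonneg_left h1 hss.le).trans h2
    have e : t - s = (√t - √s) * (√t + √s) := by
      have a := Real.mul_self_sqrt ht.le
      have b := Real.mul_self_sqrt hs.le
      nlinarith
    rw [e] at h3
    have h4 : (√t - √s) * (π * M * (√s * (√t + √s))) ≤ (√t - √s) * theta t := by nlinarith
    exact le_of_mul_le_mul_left h4 (sub_pos.2 hlt)
  have hcont : Filter.Tendsto (fun s => π * M * (√s * (√t + √s))) (nhdsWithin t (Set.Iio t))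
      (nhds (π * M * (√t * (√t + √t)))) :=
    Filter.Tendsto.mono_left (Continuous.tendsto (by fun_prop) t) nhdsWithin_le_nhds
  have := le_of_tendsto hcont (by
    filter_upwards [Ioo_mem_nhdsLT ht] with s hs using key s hs.1 hs.2)
  have a := Real.mul_self_sqrt ht.le
  calc 2 * π * t * M = π * M * (√t * (√t + √t)) := by rw [mul_add, a]; ring
    _ ≤ _ := this

end Theta

/-! ### Gaussian sums over a lattice and the test channel -/

section Lattice
open Real

theorem gaussianPDFReal_toNNReal {v : ℝ} (hv : 0 < v) (μ x : ℝ) :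
    gaussianPDFReal μ v.toNNReal x = (√(2 * π * v))⁻¹ * Real.exp (-(x - μ) ^ 2 / (2 * v)) := by
  rw [gaussianPDFReal, Real.coe_toNNReal _ hv.le]

/-- Completing the square: the joint density of a Gaussian input and of its noisy observation
factors into the density of the observation and the posterior density of the input. -/
theorem gaussianPDFReal_mul_posterior {v w : ℝ} (hv : 0 < v) (hw : 0 < w) (x y : ℝ) :
    gaussianPDFReal 0 v.toNNReal x * gaussianPDFReal x w.toNNReal y =
      gaussianPDFReal 0 (v + w).toNNReal y *
        gaussianPDFReal (v / (v + w) * y) (v * w / (v + w)).toNNReal x := by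
  have hvw : 0 < v + w := by positivity
  rw [gaussianPDFReal_toNNReal hv, gaussianPDFReal_toNNReal hw, gaussianPDFReal_toNNReal hvw,
    gaussianPDFReal_toNNReal (by positivity), mul_mul_mul_comm (√(2 * π * v))⁻¹,
    mul_mul_mul_comm (√(2 * π * (v + w)))⁻¹, ← mul_inv,
    ← mul_inv, ← Real.exp_add, ← Real.exp_add, ← sqrt_mul (by positivity),
    ← sqrt_mul (by positivity)]
  congr 1
  · congr 2
    field_simp
  · congr 1
    field_simp
    ring

/-- The terms of a Gaussian sum over `ηℤ`, in the form in which Poisson summation yields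
`θ(2 π v / η ^ 2)`. -/
theorem exp_lattice_eq {v η : ℝ} (hv : 0 < v) (hη : 0 < η) (n : ℤ) (x : ℝ) :
    Real.exp (-(η * n - x) ^ 2 / (2 * v)) =
      Real.exp (-π / (2 * π * v / η ^ 2) * ((n : ℝ) + -x / η) ^ 2) := by
  congr 1
  field_simp
  ring

theorem sqrt_period {v η : ℝ} (hη : 0 < η) :
    √(2 * π * v / η ^ 2) = √(2 * π * v) / η := by
  rw [sqrt_div' _ (by positivity), sqrt_sq hη.le]

theorem tsum_gaussianPDFReal_lattice_ge {v η : ℝ} (hv : 0 < v) (hη : 0 < η) (x : ℝ) :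
    (2 - theta (2 * π * v / η ^ 2)) / η ≤ ∑' n : ℤ, gaussianPDFReal x v.toNNReal (η * n) := by
  have h := sqrt_mul_le_tsum_exp_shift (t := 2 * π * v / η ^ 2) (by positivity) (-x / η)
  simp_rw [gaussianPDFReal_toNNReal hv, tsum_mul_left, exp_lattice_eq hv hη]
  rw [sqrt_period hη] at h
  have hp : 0 < √(2 * π * v) := by positivity
  calc _ = (√(2 * π * v))⁻¹ * (√(2 * π * v) / η * (2 - theta (2 * π * v / η ^ 2))) := by
        field_simp
    _ ≤ _ := mul_le_mul_of_nonneg_left h (by positivity)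

theorem tsum_gaussianPDFReal_lattice {v η : ℝ} (hv : 0 < v) (hη : 0 < η) :
    ∑' n : ℤ, gaussianPDFReal 0 v.toNNReal (η * n) = theta (2 * π * v / η ^ 2) / η := by
  have ht : 0 < 2 * π * v / η ^ 2 := by positivity
  have h := theta_inv ht
  simp_rw [gaussianPDFReal_toNNReal hv, tsum_mul_left, exp_lattice_eq hv hη]
  rw [sqrt_period hη] at h
  have hp : 0 < √(2 * π * v) := by positivity
  simp only [neg_zero, zero_div, add_zero]
  rw [theta] at h
  rw [div_eq_mul_inv (-π), h]
  field_simp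

/-- The terms of a centered Gaussian sum over `ηℤ` as terms of `θ(η ^ 2 / (2 π v))`. -/
theorem exp_lattice_zero_eq {v η : ℝ} (n : ℤ) :
    Real.exp (-(η * n - 0) ^ 2 / (2 * v)) =
      Real.exp (-π * (η ^ 2 / (2 * π * v)) * (n : ℝ) ^ 2) := by
  congr 1
  field_simp
  ring

theorem summable_gaussianPDFReal_lattice {v η : ℝ} (hv : 0 < v) (hη : 0 < η) :
    Summable fun n : ℤ => gaussianPDFReal 0 v.toNNReal (η * n) := by
  simp_rw [gaussianPDFReal_toNNReal hv, exp_lattice_zero_eq]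
  exact (summable_exp_neg_sq (by positivity)).mul_left _

theorem summable_sq_mul_gaussianPDFReal_lattice {v η : ℝ} (hv : 0 < v) (hη : 0 < η) :
    Summable fun n : ℤ => (η * n) ^ 2 * gaussianPDFReal 0 v.toNNReal (η * n) := by
  simp_rw [gaussianPDFReal_toNNReal hv, exp_lattice_zero_eq]
  refine ((summable_sq_mul_exp_neg_sq (t := η ^ 2 / (2 * π * v)) (by positivity)).mul_left
    (η ^ 2 * (√(2 * π * v))⁻¹)).congr fun n => ?_
  ring

theorem tsum_sq_mul_gaussianPDFReal_lattice_le {v η : ℝ} (hv : 0 < v) (hη : 0 < η) :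
    ∑' n : ℤ, (η * n) ^ 2 * gaussianPDFReal 0 v.toNNReal (η * n) ≤
      v * ∑' n : ℤ, gaussianPDFReal 0 v.toNNReal (η * n) := by
  have h := tsum_sq_mul_exp_le (t := η ^ 2 / (2 * π * v)) (by positivity)
  simp_rw [gaussianPDFReal_toNNReal hv, exp_lattice_zero_eq]
  have e : ∀ n : ℤ, (η * n) ^ 2 * ((√(2 * π * v))⁻¹ *
      Real.exp (-π * (η ^ 2 / (2 * π * v)) * (n : ℝ) ^ 2)) = (η ^ 2 * (√(2 * π * v))⁻¹) *
        ((n : ℝ) ^ 2 * Real.exp (-π * (η ^ 2 / (2 * π * v)) * (n : ℝ) ^ 2)) := fun n => by ring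
  simp_rw [e, tsum_mul_left]
  rw [theta] at h
  set M := ∑' n : ℤ, (n : ℝ) ^ 2 * Real.exp (-π * (η ^ 2 / (2 * π * v)) * (n : ℝ) ^ 2)
  set T := ∑' n : ℤ, Real.exp (-π * (η ^ 2 / (2 * π * v)) * (n : ℝ) ^ 2)
  calc η ^ 2 * (√(2 * π * v))⁻¹ * M
      = v * ((√(2 * π * v))⁻¹ * (2 * π * (η ^ 2 / (2 * π * v)) * M)) := by field_simp
    _ ≤ _ := by gcongr

section Channel

variable {η σs Δ : ℝ}

theorem recVar_add : recVar σs Δ + Δ = σs ^ 2 := by rw [recVar]; ring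

theorem tsum_lattice_pos (hη : 0 < η) (hv : 0 < recVar σs Δ) :
    0 < ∑' j : ℤ, gaussianPDFReal 0 (recVar σs Δ).toNNReal (η * j) := by
  rw [tsum_gaussianPDFReal_lattice hv hη]
  have := one_le_theta (t := 2 * π * recVar σs Δ / η ^ 2) (by positivity)
  positivity

theorem latticeGaussian_pos (hη : 0 < η) (hv : 0 < recVar σs Δ) (k : ℤ) :
    0 < latticeGaussian η σs Δ k :=
  div_pos (gaussianPDFReal_pos _ _ _ (by simpa using hv)) (tsum_lattice_pos hη hv)

theorem summable_latticeGaussian (hη : 0 < η) (hv : 0 < recVar σs Δ) :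
    Summable (latticeGaussian η σs Δ) :=
  (summable_gaussianPDFReal_lattice hv hη).div_const _

theorem tsum_latticeGaussian (hη : 0 < η) (hv : 0 < recVar σs Δ) :
    ∑' k, latticeGaussian η σs Δ k = 1 := by
  simp only [latticeGaussian]
  rw [tsum_div_const, div_self (tsum_lattice_pos hη hv).ne']

theorem summable_sq_mul_latticeGaussian (hη : 0 < η) (hv : 0 < recVar σs Δ) :
    Summable fun k : ℤ => (η * k) ^ 2 * latticeGaussian η σs Δ k := by
  simp only [latticeGaussian, ← mul_div_assoc]
  exact (summable_sq_mul_gaussianPDFReal_lattice hv hη).div_const _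

/-- The second moment of the discrete Gaussian distribution is at most its parameter. -/
theorem tsum_sq_mul_latticeGaussian_le (hη : 0 < η) (hv : 0 < recVar σs Δ) :
    ∑' k : ℤ, (η * k) ^ 2 * latticeGaussian η σs Δ k ≤ recVar σs Δ := by
  simp only [latticeGaussian, ← mul_div_assoc]
  rw [tsum_div_const, div_le_iff₀ (tsum_lattice_pos hη hv)]
  exact tsum_sq_mul_gaussianPDFReal_lattice_le hv hη

theorem gaussianPDFReal_le (hΔ : 0 < Δ) (x y : ℝ) :
    gaussianPDFReal x Δ.toNNReal y ≤ (√(2 * π * Δ))⁻¹ := by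
  rw [gaussianPDFReal_toNNReal hΔ]
  refine mul_le_of_le_one_right (by positivity) (Real.exp_le_one_iff.2 ?_)
  rw [neg_div]
  exact neg_nonpos.2 (by positivity)

theorem summable_channel (hη : 0 < η) (hv : 0 < recVar σs Δ) (hΔ : 0 < Δ) (y : ℝ) :
    Summable fun k : ℤ => latticeGaussian η σs Δ k * gaussianPDFReal (η * k) Δ.toNNReal y :=
  ((summable_latticeGaussian hη hv).mul_right (√(2 * π * Δ))⁻¹).of_nonneg_of_le
    (fun k => mul_nonneg (latticeGaussian_pos hη hv k).le (gaussianPDFReal_nonneg _ _ _))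
    (fun k => mul_le_mul_of_nonneg_left (gaussianPDFReal_le hΔ _ _)
      (latticeGaussian_pos hη hv k).le)

/-- The deviation of the test channel output density from the source density: up to this relative
error, the source density is a lower bound for the output density. It is the sum of the flatness
factors of `ηℤ` for the posterior variance and for the input variance. -/
def flatness (η σs Δ : ℝ) : ℝ :=
  (theta (2 * π * mmseVar σs Δ / η ^ 2) - 1) + (theta (2 * π * recVar σs Δ / η ^ 2) - 1)

theorem flatness_nonneg (hη : 0 < η) (hσs : 0 < σs) (hv : 0 < recVar σs Δ) (hΔ : 0 < Δ) :
    0 ≤ flatness η σs Δ := by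
  have hm : 0 < mmseVar σs Δ := by rw [mmseVar]; positivity
  have h1 := one_le_theta (t := 2 * π * mmseVar σs Δ / η ^ 2) (by positivity)
  have h2 := one_le_theta (t := 2 * π * recVar σs Δ / η ^ 2) (by positivity)
  rw [flatness]; linarith

/-- By completing the square, the output density is the source density times the quotient of two
Gaussian sums over `ηℤ`; these are estimated from below and from above. -/
theorem one_sub_flatness_mul_le (hη : 0 < η) (hσs : 0 < σs) (hv : 0 < recVar σs Δ) (hΔ : 0 < Δ)
    (y : ℝ) :
    (1 - flatness η σs Δ) * gaussianPDFReal 0 (σs ^ 2).toNNReal y ≤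
      ∑' k : ℤ, latticeGaussian η σs Δ k * gaussianPDFReal (η * k) Δ.toNNReal y := by
  have hm : 0 < mmseVar σs Δ := by rw [mmseVar]; positivity
  have h1 := one_le_theta (t := 2 * π * mmseVar σs Δ / η ^ 2) (by positivity)
  have h2 := one_le_theta (t := 2 * π * recVar σs Δ / η ^ 2) (by positivity)
  have hlow := tsum_gaussianPDFReal_lattice_ge hm hη (mmseScale σs Δ * y)
  have hg := gaussianPDFReal_nonneg 0 (σs ^ 2).toNNReal y
  have e : ∀ k : ℤ, latticeGaussian η σs Δ k * gaussianPDFReal (η * k) Δ.toNNReal y =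
      gaussianPDFReal 0 (σs ^ 2).toNNReal y / (theta (2 * π * recVar σs Δ / η ^ 2) / η) *
        gaussianPDFReal (mmseScale σs Δ * y) (mmseVar σs Δ).toNNReal (η * k) := fun k => by
    rw [latticeGaussian, tsum_gaussianPDFReal_lattice hv hη, div_mul_eq_mul_div,
      gaussianPDFReal_mul_posterior hv hΔ, recVar_add, mul_div_right_comm]
    rfl
  simp_rw [e, tsum_mul_left]
  set a := theta (2 * π * mmseVar σs Δ / η ^ 2) - 1 with ha
  set b := theta (2 * π * recVar σs Δ / η ^ 2) - 1 with hb
  have hb' : theta (2 * π * recVar σs Δ / η ^ 2) = 1 + b := by rw [hb]; ring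
  have ha' : theta (2 * π * mmseVar σs Δ / η ^ 2) = 1 + a := by rw [ha]; ring
  have ha0 : 0 ≤ a := by linarith
  have hb0 : 0 ≤ b := by linarith
  have hfl : flatness η σs Δ = a + b := rfl
  rw [hfl, hb']
  rw [ha'] at hlow
  calc (1 - (a + b)) * gaussianPDFReal 0 (σs ^ 2).toNNReal y
      ≤ gaussianPDFReal 0 (σs ^ 2).toNNReal y * ((1 - a) / (1 + b)) := by
        rw [mul_comm]
        refine mul_le_mul_of_nonneg_left ?_ hg
        rw [le_div_iff₀ (by positivity)]
        nlinarith [mul_nonneg ha0 hb0, mul_nonneg hb0 hb0]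
    _ = gaussianPDFReal 0 (σs ^ 2).toNNReal y / ((1 + b) / η) * ((2 - (1 + a)) / η) := by
        have : (1 + b) ≠ 0 := by positivity
        field_simp
        ring
    _ ≤ _ := mul_le_mul_of_nonneg_left hlow (by positivity)

/-- The mean square error of the linear estimate `α y` of the channel input, when the noise is
averaged: bias and variance. -/
theorem integral_sq_mul_gaussianPDFReal (hΔ : 0 < Δ) (a x : ℝ) :
    Integrable (fun y => (a * y - x) ^ 2 * gaussianPDFReal x Δ.toNNReal y) ∧
    ∫ y, (a * y - x) ^ 2 * gaussianPDFReal x Δ.toNNReal y = (a - 1) ^ 2 * x ^ 2 + a ^ 2 * Δ := by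
  have hne : Δ.toNNReal ≠ 0 := by simpa using hΔ
  have hL : MemLp (fun y => a * y - x) 2 (gaussianReal x Δ.toNNReal) :=
    ((memLp_id_gaussianReal 2).const_mul a).sub (memLp_const x)
  have hE : ∫ y, (a * y - x) ∂gaussianReal x Δ.toNNReal = a * x - x := by
    have hi : Integrable (fun y : ℝ => y) (gaussianReal x Δ.toNNReal) :=
      (memLp_id_gaussianReal 1).integrable (by norm_num)
    rw [integral_sub (hi.const_mul a) (integrable_const x), integral_const_mul,
      integral_id_gaussianReal]
    simp
  have hV : Var[fun y => a * y - x; gaussianReal x Δ.toNNReal] = a ^ 2 * Δ := by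
    have : (fun y => a * y - x) = fun y => (a * y) + (-x) := by ext; ring
    rw [this, variance_add_const (by fun_prop), variance_const_mul, variance_fun_id_gaussianReal,
      Real.coe_toNNReal _ hΔ.le]
  have h2 := variance_eq_sub hL
  rw [hV, hE] at h2
  have hint := hL.integrable_sq
  constructor
  · rw [gaussianReal_of_var_ne_zero _ hne, gaussianPDF_def,
      integrable_withDensity_iff_integrable_smul₀'] at hint
    · refine hint.congr (Filter.Eventually.of_forall fun y => ?_)
      simp only [smul_eq_mul]
      rw [ENNReal.toReal_ofReal (gaussianPDFReal_nonneg _ _ _), mul_comm]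
    · exact (measurable_gaussianPDFReal _ _).ennreal_ofReal.aemeasurable
    · simp
  · have h3 := integral_gaussianReal_eq_integral_smul (μ := x) hne (f := fun y => (a * y - x) ^ 2)
    simp only [smul_eq_mul] at h3
    simp_rw [mul_comm _ (gaussianPDFReal _ _ _)]
    rw [← h3]
    simp only [Pi.pow_apply] at h2
    linarith

end Channel

end Lattice

/-! ### Sequential drawing of dependent bits -/

section Sequential

/-- A function of a bit array which does not depend on the bits with index in `s`. -/
def IndepOf {ι : Type*} (F : (ι → ZMod 2) → ℝ) (s : Set ι) : Prop :=
  ∀ u w : ι → ZMod 2, (∀ i, i ∉ s → u i = w i) → F u = F w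

/-- The bit array `u` with the bit of index `a` flipped. -/
def flipBit {ι : Type*} [DecidableEq ι] (a : ι) (u : ι → ZMod 2) : ι → ZMod 2 :=
  Function.update u a (u a + 1)

theorem flipBit_involutive {ι : Type*} [DecidableEq ι] (a : ι) :
    Function.Involutive (flipBit a) := by
  intro u
  ext i
  by_cases h : i = a
  · subst h
    have : (1 : ZMod 2) + 1 = 0 := by decide
    simp [flipBit, add_assoc, this]
  · simp [flipBit, h]

theorem IndepOf.flipBit_eq {ι : Type*} [DecidableEq ι] {F : (ι → ZMod 2) → ℝ} {s : Set ι}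
    (hF : IndepOf F s) {a : ι}
    (ha : a ∈ s) (u : ι → ZMod 2) : F (flipBit a u) = F u :=
  hF _ _ fun i hi => Function.update_of_ne (fun h => hi (by rwa [h])) _ _

open Classical in
/-- The marginal of `p` on the bits with index in `s`, evaluated at the bits of `u`. -/
def marginal {ι : Type*} [Fintype ι] [DecidableEq ι] (p : (ι → ZMod 2) → ℝ)
    (s : Set ι) (u : ι → ZMod 2) : ℝ :=
  ∑ w : ι → ZMod 2 with ∀ i ∈ s, w i = u i, p w

theorem marginal_indepOf {ι : Type*} [Fintype ι] [DecidableEq ι]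
    (p : (ι → ZMod 2) → ℝ) (s : Set ι) :
    IndepOf (marginal p s) sᶜ := by
  intro u w h
  unfold marginal
  congr 1
  ext x
  simp only [Finset.mem_filter, Finset.mem_univ, true_and]
  refine forall₂_congr fun i hi => ?_
  rw [h i (by simpa using hi)]

theorem marginal_pos {ι : Type*} [Fintype ι] [DecidableEq ι] {p : (ι → ZMod 2) → ℝ}
    (hp : ∀ u, 0 < p u) (s : Set ι) (u : ι → ZMod 2) :
    0 < marginal p s u :=
  Finset.sum_pos (fun w _ => hp w) ⟨u, by simp⟩

theorem marginal_empty {ι : Type*} [Fintype ι] [DecidableEq ι]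
    (p : (ι → ZMod 2) → ℝ) (u : ι → ZMod 2) :
    marginal p ∅ u = ∑ w, p w := by
  classical
  unfold marginal
  congr 1
  ext
  simp

theorem marginal_univ {ι : Type*} [Fintype ι] [DecidableEq ι]
    (p : (ι → ZMod 2) → ℝ) (u : ι → ZMod 2) :
    marginal p Set.univ u = p u := by
  rw [marginal, ← Finset.sum_singleton p u]
  congr 1
  ext w
  simp [funext_iff]

variable {ι : Type*} [Fintype ι] [LinearOrder ι]

/-- A system of conditional distributions: `b i` only depends on the bits up to `i`, and it is a
probability as a function of the bit `i`. -/
structure IsCond (b : ι → (ι → ZMod 2) → ℝ) : Prop where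
  indep : ∀ i, IndepOf (b i) (Set.Ioi i)
  nonneg : ∀ i u, 0 ≤ b i u
  add_flipBit : ∀ i u, b i u + b i (flipBit i u) = 1

/-- Conditional probabilities of future bits can be summed out. As the sum runs over all bits, each
of them leaves a factor `1 / 2`, in place of the sum over the two values of its bit. -/
theorem IsCond.sum_mul_prod {b : ι → (ι → ZMod 2) → ℝ} (hb : IsCond b) (s : Finset ι) :
    ∀ F : (ι → ZMod 2) → ℝ, IndepOf F (s : Set ι) →
      ∑ u, F u * ∏ i ∈ s, b i u = (∑ u, F u) / 2 ^ s.card := by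
  induction s using Finset.induction_on_max with
  | empty => simp
  | insert a s has ih =>
    intro F hF
    have hna : a ∉ s := fun h => lt_irrefl _ (has a h)
    have hFs : IndepOf F (s : Set ι) := fun u w h => hF u w fun i hi => h i fun his =>
      hi (by simp [Finset.mem_coe.1 his])
    have hinv : ∀ u, F (flipBit a u) * ∏ i ∈ s, b i (flipBit a u) =
        F u * ∏ i ∈ s, b i u := fun u => by
      rw [hF.flipBit_eq (by simp)]
      congr 1
      exact Finset.prod_congr rfl fun i hi => (hb.indep i).flipBit_eq (has i hi) u
    -- Flipping the largest index leaves all factors but `b a` unchanged.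
    have h1 : ∑ u, F u * ∏ i ∈ insert a s, b i u =
        ∑ u, (F u * ∏ i ∈ s, b i u) * b a (flipBit a u) := by
      rw [← Equiv.sum_comp (flipBit_involutive a).toPerm]
      refine Finset.sum_congr rfl fun u _ => ?_
      rw [Function.Involutive.coe_toPerm, Finset.prod_insert hna, ← hinv u]
      ring
    have h2 : ∑ u, F u * ∏ i ∈ insert a s, b i u = ∑ u, (F u * ∏ i ∈ s, b i u) * b a u :=
      Finset.sum_congr rfl fun u _ => by rw [Finset.prod_insert hna]; ring
    have h3 : 2 * ∑ u, F u * ∏ i ∈ insert a s, b i u = ∑ u, F u * ∏ i ∈ s, b i u := by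
      rw [two_mul]
      nth_rewrite 1 [h2]
      rw [h1, ← Finset.sum_add_distrib]
      refine Finset.sum_congr rfl fun u _ => ?_
      rw [← mul_add, hb.add_flipBit, mul_one]
    rw [ih F hFs] at h3
    rw [Finset.card_insert_of_notMem hna, pow_succ]
    field_simp at h3 ⊢
    linarith

theorem IsCond.sum_prod {b : ι → (ι → ZMod 2) → ℝ} (hb : IsCond b) :
    ∑ u, ∏ i, b i u = 1 := by
  have := hb.sum_mul_prod Finset.univ (fun _ => 1) (fun _ _ _ => rfl)
  simpa [ZMod.card] using this

theorem marginal_Iic_add_flipBit (p : (ι → ZMod 2) → ℝ) (a : ι) (u : ι → ZMod 2) :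
    marginal p (Set.Iic a) u + marginal p (Set.Iic a) (flipBit a u) = marginal p (Set.Iio a) u := by
  classical
  unfold marginal
  have hne : ∀ x : ZMod 2, x ≠ x + 1 := by decide
  have hor : ∀ x y : ZMod 2, x = y ∨ x = y + 1 := by decide
  rw [← Finset.sum_union]
  · refine Finset.sum_congr ?_ fun _ _ => rfl
    ext w
    simp only [Finset.mem_union, Finset.mem_filter, Finset.mem_univ, true_and, Set.mem_Iic,
      Set.mem_Iio]
    constructor
    · rintro (h | h) i hi
      · exact h i hi.le
      · rw [h i hi.le, flipBit, Function.update_of_ne hi.ne]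
    · intro h
      rcases hor (w a) (u a) with ha | ha
      · refine Or.inl fun i hi => ?_
        rcases hi.lt_or_eq with hi | rfl
        exacts [h i hi, ha]
      · refine Or.inr fun i hi => ?_
        rcases hi.lt_or_eq with hi | rfl
        · rw [h i hi, flipBit, Function.update_of_ne hi.ne]
        · rw [ha, flipBit, Function.update_self]
  · rw [Finset.disjoint_left]
    intro w h1 h2
    simp only [Finset.mem_filter, Finset.mem_univ, true_and, Set.mem_Iic] at h1 h2
    have := h2 a le_rfl
    rw [h1 a le_rfl, flipBit, Function.update_self] at this
    exact hne _ this

/-- The conditional probability, under `p`, of the bit `u i` given the preceding bits. -/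
def seqCond (p : (ι → ZMod 2) → ℝ) (i : ι) (u : ι → ZMod 2) : ℝ :=
  marginal p (Set.Iic i) u / marginal p (Set.Iio i) u

open Classical in
/-- The conditional probabilities of a bit array whose bits in `S` are drawn from the
conditional distributions of `p`, and whose other bits are uniformly random. -/
def hybridCond (p : (ι → ZMod 2) → ℝ) (S : Set ι) (i : ι) (u : ι → ZMod 2) : ℝ :=
  if i ∈ S then seqCond p i u else 1 / 2

theorem isCond_hybridCond {p : (ι → ZMod 2) → ℝ} (hp : ∀ u, 0 < p u) (S : Set ι) :
    IsCond (hybridCond p S) where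
  indep i u w h := by
    unfold hybridCond seqCond
    rw [marginal_indepOf p (Set.Iic i) u w (fun j hj => h j (by simpa using hj)),
      marginal_indepOf p (Set.Iio i) u w (fun j hj => h j fun hj' => hj (by simpa using hj'.le))]
  nonneg i u := by
    unfold hybridCond seqCond
    split_ifs
    · exact div_nonneg (marginal_pos hp _ _).le (marginal_pos hp _ _).le
    · norm_num
  add_flipBit i u := by
    unfold hybridCond seqCond
    split_ifs
    · rw [(marginal_indepOf p (Set.Iio i)).flipBit_eq (a := i) (by simp) u, ← add_div,
        marginal_Iic_add_flipBit,
        div_self (marginal_pos hp _ _).ne']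
    · norm_num

/-- Replacing the conditional distributions outside `S` by uniform ones changes the joint
distribution by at most the sum of the changes at the single indices. The joint distributions in
which the bits are drawn correctly up to some index interpolate between the two. -/
theorem sum_abs_hybrid_sub_le {p : (ι → ZMod 2) → ℝ} (hp : ∀ u, 0 < p u) (S : Set ι)
    [DecidablePred (· ∈ S)] :
    ∑ u, |(∑ w, p w) * ∏ i, hybridCond p S i u - p u| ≤
      ∑ i with i ∉ S, (∑ u, |marginal p (Set.Iio i) u / 2 - marginal p (Set.Iic i) u|) /
        2 ^ (Finset.univ.filter (i < ·)).card := by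
  classical
  set b := hybridCond p S with hb_def
  have hb : IsCond b := isCond_hybridCond hp S
  set E : ι → ℝ := fun i => if i ∈ S then 0 else
    (∑ u, |marginal p (Set.Iio i) u / 2 - marginal p (Set.Iic i) u|) /
        2 ^ (Finset.univ.filter (i < ·)).card with hE
  set H : Finset ι → (ι → ZMod 2) → ℝ := fun s u => marginal p s u * ∏ i ∈ sᶜ, b i u with hH
  -- `H s` draws the bits of the lower set `s` from `p` and the other bits from `b`.
  have step : ∀ a, ∑ u, |H (Finset.univ.filter (· < a)) u -
      H (insert a (Finset.univ.filter (· < a))) u| = E a := by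
    intro a
    set s := Finset.univ.filter (· < a) with hs
    have hna : a ∉ s := by simp [hs]
    have hs1 : (s : Set ι) = Set.Iio a := by ext; simp [hs]
    have hs2 : ((insert a s : Finset ι) : Set ι) = Set.Iic a := by
      ext x; simp [hs, le_iff_eq_or_lt]
    have hc : (insert a s)ᶜ = Finset.univ.filter (a < ·) := by
      ext x; simp only [hs, Finset.mem_compl, Finset.mem_insert, Finset.mem_filter,
        Finset.mem_univ, true_and, ← le_iff_eq_or_lt, not_le]
    have hc' : sᶜ = insert a (insert a s)ᶜ := by
      ext x; simp only [Finset.mem_compl, Finset.mem_insert]; grind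
    have e : ∀ u, |H s u - H (insert a s) u| =
        |marginal p (Set.Iio a) u * b a u - marginal p (Set.Iic a) u| *
          ∏ i ∈ Finset.univ.filter (a < ·), b i u := fun u => by
      simp only [hH]
      rw [hs1, hs2, hc', Finset.prod_insert (by simp), hc, ← mul_assoc, ← sub_mul, abs_mul,
        abs_of_nonneg (Finset.prod_nonneg fun i _ => hb.nonneg i u)]
    simp_rw [e]
    rw [hb.sum_mul_prod]
    · simp only [hE, hb_def, hybridCond, seqCond]
      split_ifs with h
      · rw [Finset.sum_eq_zero, zero_div]
        intro u _
        rw [mul_div_cancel₀ _ (marginal_pos hp _ _).ne', sub_self, abs_zero]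
      · simp only [mul_one_div]
    · intro u w h
      have h' : ∀ i, i ∉ Set.Ioi a → u i = w i := fun i hi => h i (by simpa using hi)
      beta_reduce
      rw [hb.indep a u w h', marginal_indepOf p (Set.Iic a) u w (by simpa using h'),
        marginal_indepOf p (Set.Iio a) u w fun i hi => h' i fun hi' => hi (by simpa using hi'.le)]
  have main : ∀ s : Finset ι, IsLowerSet (s : Set ι) →
      ∑ u, |H ∅ u - H s u| ≤ ∑ i ∈ s, E i := by
    intro s
    induction s using Finset.induction_on_max with
    | empty => simp
    | insert a s has ih =>
      intro hlow
      have hna : a ∉ s := fun h => lt_irrefl _ (has a h)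
      have hsa : s = Finset.univ.filter (· < a) := by
        ext x
        simp only [Finset.mem_filter, Finset.mem_univ, true_and]
        refine ⟨has x, fun hx => ?_⟩
        have : x ∈ insert a s := by
          exact_mod_cast hlow hx.le (Finset.mem_coe.2 (Finset.mem_insert_self a s))
        exact (Finset.mem_insert.1 this).resolve_left hx.ne
      have hlow' : IsLowerSet (s : Set ι) := by
        rw [hsa]
        intro x y hyx hx
        simp only [Finset.coe_filter, Finset.mem_univ, true_and, Set.mem_ofPred_eq] at hx ⊢
        exact hyx.trans_lt hx
      rw [Finset.sum_insert hna, ← step a, ← hsa, add_comm]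
      calc ∑ u, |H ∅ u - H (insert a s) u|
          ≤ ∑ u, (|H ∅ u - H s u| + |H s u - H (insert a s) u|) :=
            Finset.sum_le_sum fun u _ => abs_sub_le _ _ _
        _ ≤ _ := by rw [Finset.sum_add_distrib]; gcongr; exact ih hlow'
  have := main Finset.univ (by simpa using isLowerSet_univ)
  rw [Finset.sum_filter]
  convert! this using 1
  · refine Finset.sum_congr rfl fun u _ => ?_
    simp only [hH, Finset.coe_empty, marginal_empty, Finset.compl_empty, Finset.coe_univ,
      marginal_univ, Finset.compl_univ, Finset.prod_empty, mul_one]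
  · refine Finset.sum_congr rfl fun i _ => ?_
    simp only [hE, ite_not]

end Sequential

/-! ### The polar transform and the law of the quantizer -/

section Transform

theorem polarG_mul_self : ∀ m : ℕ, polarG m * polarG m = 1
  | 0 => by simp [polarG]
  | m + 1 => by
    have h2 : (!![1, 0; 1, 1] * !![1, 0; 1, 1] : Matrix (Fin 2) (Fin 2) (ZMod 2)) = 1 := by
      decide
    have h : (Matrix.kroneckerMap (fun a b => a * b)
          (!![1, 0; 1, 1] : Matrix (Fin 2) (Fin 2) (ZMod 2)) (polarG m)) *
        (Matrix.kroneckerMap (fun a b => a * b)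
          (!![1, 0; 1, 1] : Matrix (Fin 2) (Fin 2) (ZMod 2)) (polarG m)) = 1 := by
      have := Matrix.mul_kronecker_mul (!![1, 0; 1, 1] : Matrix (Fin 2) (Fin 2) (ZMod 2))
        !![1, 0; 1, 1] (polarG m) (polarG m)
      rw [h2, polarG_mul_self m, Matrix.one_kronecker_one] at this
      exact this.symm
    rw [polarG, Matrix.reindex_apply, Matrix.submatrix_mul_equiv, h, Matrix.submatrix_one_equiv]

variable {m r : ℕ}

theorem transform_transform (x : Bits m r) : transform (transform x) = x := by
  ext ℓ i
  simp [transform, Matrix.vecMul_vecMul, polarG_mul_self]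

theorem apply_eq_transform_iff (x u : Bits m r) (j : Fin r) :
    x j = transform u j ↔ transform x j = u j := by
  constructor <;> intro h
  · have : transform x j = transform (transform u) j := by simp only [transform] at h ⊢; rw [h]
    rw [this, transform_transform]
  · have : transform (transform x) j = transform u j := by simp only [transform] at h ⊢; rw [h]
    rw [← this, transform_transform]

/-- The positions `(ℓ, i)` of the bits, in the order in which the quantizer determines them. -/
abbrev Pos (m r : ℕ) : Type := Fin r ×ₗ Fin (2 ^ m)

/-- A bit array, as a function of the position. -/
def bitsEquiv (m r : ℕ) : Bits m r ≃ (Pos m r → ZMod 2) :=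
  (Equiv.curry (Fin r) (Fin (2 ^ m)) (ZMod 2)).symm.trans (Equiv.arrowCongr toLex (Equiv.refl _))

theorem bitsEquiv_apply (u : Bits m r) (k : Pos m r) :
    bitsEquiv m r u k = u (ofLex k).1 (ofLex k).2 := rfl

/-- The data which precede the bit `(ℓ, i)` are equivalent to the bits at the preceding positions:
the transform is invertible, so the coset labels of the earlier levels determine their bits. -/
theorem past_eq_iff (ℓ : Fin r) (i : Fin (2 ^ m)) (x u : Bits m r) :
    past ℓ i x (transform x) = past ℓ i (transform u) u ↔
      ∀ k ∈ Set.Iio (toLex (ℓ, i) : Pos m r),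
        bitsEquiv m r (transform x) k = bitsEquiv m r u k := by
  simp only [past, Prod.mk.injEq, funext_iff (f := fun j : {j : Fin r // j < ℓ} => x j),
    funext_iff (f := fun k : {k : Fin (2 ^ m) // k < i} => transform x ℓ k), Subtype.forall,
    apply_eq_transform_iff, Set.mem_Iio, bitsEquiv_apply]
  constructor
  · rintro ⟨h1, h2⟩ k hk
    rcases Prod.Lex.lt_iff.1 hk with h | ⟨h, h'⟩
    · exact congrFun (h1 _ h) _
    · have h : (ofLex k).1 = ℓ := h
      rw [h]
      exact h2 _ h'
  · intro h
    refine ⟨fun j hj => funext fun k => h (toLex (j, k)) (Prod.Lex.lt_iff.2 (Or.inl hj)),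
      fun k hk => h (toLex (ℓ, k)) (Prod.Lex.lt_iff.2 (Or.inr ⟨rfl, hk⟩))⟩

/-- The joint density of the bits `U` and of the test channel output, at the output `y` and as a
function of the bits, indexed by their positions. -/
def seqDensity (η σs Δ : ℝ) (y : Fin (2 ^ m) → ℝ) (w : Pos m r → ZMod 2) : ℝ :=
  blockDensity η σs Δ (transform ((bitsEquiv m r).symm w)) y

variable (η σs Δ β : ℝ)

theorem sum_seqDensity (y : Fin (2 ^ m) → ℝ) :
    ∑ w : Pos m r → ZMod 2, seqDensity η σs Δ y w =
      ∑ x : Bits m r, blockDensity η σs Δ x y := by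
  let E : Bits m r ≃ Bits m r := Function.Involutive.toPerm transform transform_transform
  rw [← Equiv.sum_comp (bitsEquiv m r), ← Equiv.sum_comp E]
  refine Finset.sum_congr rfl fun x _ => ?_
  simp only [seqDensity, Equiv.symm_apply_apply]
  rw [show E x = transform x from rfl, transform_transform]

theorem bitDensity_eq_marginal (ℓ : Fin r) (i : Fin (2 ^ m)) (v : ZMod 2) (u : Bits m r)
    (y : Fin (2 ^ m) → ℝ) :
    bitDensity η σs Δ ℓ i v (past ℓ i (transform u) u) y =
      marginal (seqDensity η σs Δ y) (Set.Iic (toLex (ℓ, i)))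
        (Function.update (bitsEquiv m r u) (toLex (ℓ, i)) v) := by
  let E : Bits m r ≃ Bits m r := Function.Involutive.toPerm transform transform_transform
  unfold bitDensity marginal
  refine Finset.sum_equiv (E.trans (bitsEquiv m r)) (fun x => ?_) (fun x _ => ?_)
  · simp only [Finset.mem_filter, Finset.mem_univ, true_and, past_eq_iff]
    set a : Pos m r := toLex (ℓ, i) with ha
    have e : (E.trans (bitsEquiv m r)) x = bitsEquiv m r (transform x) := rfl
    have e2 : transform x ℓ i = bitsEquiv m r (transform x) a := rfl
    rw [e, e2]
    constructor
    · rintro ⟨h1, h2⟩ k hk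
      rcases (Set.mem_Iic.1 hk).lt_or_eq with h | h
      · rw [Function.update_of_ne h.ne, h1 k h]
      · rw [h, h2, Function.update_self]
    · intro h
      refine ⟨fun k hk => ?_, ?_⟩
      · rw [h k (Set.mem_Iic.2 (Set.mem_Iio.1 hk).le),
          Function.update_of_ne (Set.mem_Iio.1 hk).ne]
      · rw [h a (Set.mem_Iic.2 le_rfl), Function.update_self]
  · simp only [seqDensity, Equiv.trans_apply, Equiv.symm_apply_apply]
    rw [show E x = transform x from rfl, transform_transform]

theorem zmod_two_add {f : ZMod 2 → ℝ} (v : ZMod 2) : f 0 + f 1 = f v + f (v + 1) := by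
  have h : v = 0 ∨ v = 1 := by revert v; decide
  have h1 : (1 : ZMod 2) + 1 = 0 := by decide
  rcases h with rfl | rfl
  · simp
  · rw [h1, add_comm]

theorem bitDensity_self (ℓ : Fin r) (i : Fin (2 ^ m)) (u : Bits m r) (y : Fin (2 ^ m) → ℝ) :
    bitDensity η σs Δ ℓ i (u ℓ i) (past ℓ i (transform u) u) y =
      marginal (seqDensity η σs Δ y) (Set.Iic (toLex (ℓ, i))) (bitsEquiv m r u) := by
  rw [bitDensity_eq_marginal]
  congr 1
  exact Function.update_eq_self _ _

theorem bitDensity_add (ℓ : Fin r) (i : Fin (2 ^ m)) (u : Bits m r) (y : Fin (2 ^ m) → ℝ) :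
    bitDensity η σs Δ ℓ i 0 (past ℓ i (transform u) u) y +
        bitDensity η σs Δ ℓ i 1 (past ℓ i (transform u) u) y =
      marginal (seqDensity η σs Δ y) (Set.Iio (toLex (ℓ, i))) (bitsEquiv m r u) := by
  rw [zmod_two_add (f := fun v => bitDensity η σs Δ ℓ i v (past ℓ i (transform u) u) y) (u ℓ i),
    bitDensity_self, ← marginal_Iic_add_flipBit, bitDensity_eq_marginal]
  rfl

theorem bitCond_eq_seqCond (ℓ : Fin r) (i : Fin (2 ^ m)) (u : Bits m r) (y : Fin (2 ^ m) → ℝ) :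
    bitCond η σs Δ ℓ i (u ℓ i) (past ℓ i (transform u) u) y =
      seqCond (seqDensity η σs Δ y) (toLex (ℓ, i)) (bitsEquiv m r u) := by
  rw [bitCond, bitDensity_self, bitDensity_add, seqCond]

/-- The positions of the information bits. -/
def infoPos (m r : ℕ) : Set (Pos m r) :=
  {k | (ofLex k).2 ∈ infoSet η σs Δ β (ofLex k).1}

/-- Averaged over the frozen bits, the quantizer draws the frozen bits uniformly. -/
theorem average_quantizerProb (u : Bits m r) (y : Fin (2 ^ m) → ℝ) :
    (∑ ubar : Bits m r, quantizerProb η σs Δ β ubar u y) =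
      Fintype.card (Bits m r) * ∏ k, hybridCond (seqDensity η σs Δ y) (infoPos η σs Δ β m r) k
        (bitsEquiv m r u) := by
  classical
  have hcard : (Fintype.card (Bits m r) : ℝ) = ∏ _ℓ : Fin r, ∏ _i : Fin (2 ^ m), (2 : ℝ) := by
    simp [ZMod.card]
  have hpos : ∀ F : Pos m r → ℝ, ∏ k, F k = ∏ ℓ, ∏ i, F (toLex (ℓ, i)) := fun F => by
    rw [← Equiv.prod_comp toLex, Fintype.prod_prod_type]
  rw [hpos, hcard]
  simp only [quantizerProb, ← Finset.prod_mul_distrib]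
  have e := Fintype.prod_sum (fun (ℓ : Fin r) (row : Fin (2 ^ m) → ZMod 2) => ∏ i,
    if i ∈ infoSet η σs Δ β ℓ then bitCond η σs Δ ℓ i (u ℓ i) (past ℓ i (transform u) u) y
    else if u ℓ i = row i then 1 else 0)
  rw [← e]
  refine Finset.prod_congr rfl fun ℓ _ => ?_
  have e' := Fintype.prod_sum (fun (i : Fin (2 ^ m)) (v : ZMod 2) =>
    if i ∈ infoSet η σs Δ β ℓ then bitCond η σs Δ ℓ i (u ℓ i) (past ℓ i (transform u) u) y
    else if u ℓ i = v then 1 else 0)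
  rw [← e']
  refine Finset.prod_congr rfl fun i _ => ?_
  simp only [hybridCond, infoPos, Set.mem_ofPred_eq, ofLex_toLex]
  by_cases h : i ∈ infoSet η σs Δ β ℓ
  · simp [h, bitCond_eq_seqCond, ZMod.card]
  · simp [h]

/-- The change caused by a frozen bit, in terms of the joint density of this bit and its past. -/
theorem frozen_term_le (ℓ : Fin r) (i : Fin (2 ^ m)) (y : Fin (2 ^ m) → ℝ) :
    (∑ w, |marginal (seqDensity η σs Δ y) (Set.Iio (toLex (ℓ, i) : Pos m r)) w / 2 -
        marginal (seqDensity η σs Δ y) (Set.Iic (toLex (ℓ, i))) w|) /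
        2 ^ (Finset.univ.filter ((toLex (ℓ, i) : Pos m r) < ·)).card ≤
      ∑ s : Past m r ℓ i, |bitDensity η σs Δ ℓ i 0 s y - bitDensity η σs Δ ℓ i 1 s y| := by
  classical
  set a : Pos m r := toLex (ℓ, i) with ha
  set G : Past m r ℓ i → ℝ :=
    fun s => |bitDensity η σs Δ ℓ i 0 s y - bitDensity η σs Δ ℓ i 1 s y| with hG
  set pst : (Pos m r → ZMod 2) → Past m r ℓ i := fun w =>
    past ℓ i (transform ((bitsEquiv m r).symm w)) ((bitsEquiv m r).symm w) with hpst
  have hpst_iff : ∀ w w', pst w = pst w' ↔ ∀ k < a, w k = w' k := fun w w' => by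
    have := past_eq_iff ℓ i (transform ((bitsEquiv m r).symm w)) ((bitsEquiv m r).symm w')
    simpa [transform_transform, hpst] using this
  have hterm : ∀ w, |marginal (seqDensity η σs Δ y) (Set.Iio a) w / 2 -
      marginal (seqDensity η σs Δ y) (Set.Iic a) w| = G (pst w) / 2 := fun w => by
    have h1 := bitDensity_add η σs Δ ℓ i ((bitsEquiv m r).symm w) y
    have h2 := bitDensity_self η σs Δ ℓ i ((bitsEquiv m r).symm w) y
    rw [Equiv.apply_symm_apply, ← ha] at h1 h2
    rw [← h1, ← h2]
    have h : (bitsEquiv m r).symm w ℓ i = 0 ∨ (bitsEquiv m r).symm w ℓ i = 1 := by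
      generalize (bitsEquiv m r).symm w ℓ i = v
      revert v; decide
    rw [← abs_of_pos (two_pos (α := ℝ)), hG, ← abs_div]
    rcases h with h | h <;> rw [h]
    · rw [← abs_neg]; congr 1; simp only [hpst, abs_two]; ring
    · congr 1; simp only [hpst, abs_two]; ring
  -- The bits from `a` on are summed out by fixing them to be `0`.
  set b : Pos m r → (Pos m r → ZMod 2) → ℝ := fun k w => if w k = 0 then 1 else 0 with hb_def
  have hb : IsCond b :=
    { indep := fun k u w h => by simp only [hb_def]; rw [h k (by simp)]
      nonneg := fun k u => by simp only [hb_def]; split_ifs <;> norm_num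
      add_flipBit := fun k u => by
        simp only [hb_def, flipBit, Function.update_self]
        generalize u k = v
        have h : v = 0 ∨ v = 1 := by revert v; decide
        have h1 : (1 : ZMod 2) + 1 = 0 := by decide
        rcases h with rfl | rfl <;> simp [h1] }
  set t : Finset (Pos m r) := insert a (Finset.univ.filter (a < ·)) with ht
  have hmem : ∀ k, k ∉ t ↔ k < a := fun k => by
    simp only [ht, Finset.mem_insert, Finset.mem_filter, Finset.mem_univ, true_and]
    rw [not_or, not_lt]
    exact ⟨fun h => lt_of_le_of_ne h.2 h.1, fun h => ⟨h.ne, h.le⟩⟩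
  have h1 := hb.sum_mul_prod t (fun w => G (pst w)) (fun u w h => by
    beta_reduce
    rw [(hpst_iff u w).2 fun k hk => h k (by simpa using (hmem k).2 hk)])
  have hcard : t.card = (Finset.univ.filter (a < ·)).card + 1 := by
    rw [ht, Finset.card_insert_of_notMem (by simp)]
  have h2 : ∑ w, G (pst w) * ∏ k ∈ t, b k w ≤ ∑ s, G s := by
    have e : ∀ w, G (pst w) * ∏ k ∈ t, b k w = if ∀ k ∈ t, w k = 0 then G (pst w) else 0 :=
      fun w => by simp only [hb_def, Finset.prod_ite_zero, Finset.prod_const_one, mul_ite, mul_one,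
        mul_zero]
    simp_rw [e]
    rw [← Finset.sum_filter, ← Finset.sum_image (f := G) (g := pst)]
    · exact Finset.sum_le_univ_sum_of_nonneg fun s => abs_nonneg _
    · intro w hw w' hw' h
      simp only [Finset.coe_filter, Finset.mem_univ, true_and, Set.mem_ofPred_eq] at hw hw'
      ext k
      by_cases hk : k ∈ t
      · rw [hw k hk, hw' k hk]
      · exact (hpst_iff w w').1 h k ((hmem k).1 hk)
  simp_rw [hterm]
  rw [← Finset.sum_div, div_div, ← pow_succ', ← hcard, ← h1]
  exact h2

/-- For a fixed channel output `y`, the `L¹` distance between the output of the quantizer and the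
law of the bits of the test channel. -/
theorem sum_abs_quantizer_sub_le {y : Fin (2 ^ m) → ℝ}
    (hpos : ∀ x : Bits m r, 0 < blockDensity η σs Δ x y) [∀ ℓ : Fin r,
      DecidablePred (· ∈ infoSet (m := m) η σs Δ β ℓ)] :
    ∑ u : Bits m r, |(∑ x : Bits m r, blockDensity η σs Δ x y) *
        ∏ k, hybridCond (seqDensity η σs Δ y) (infoPos η σs Δ β m r) k (bitsEquiv m r u) -
        blockDensity η σs Δ (transform u) y| ≤
      ∑ ℓ : Fin r, ∑ i with i ∉ infoSet η σs Δ β ℓ, ∑ s : Past m r ℓ i,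
        |bitDensity η σs Δ ℓ i 0 s y - bitDensity η σs Δ ℓ i 1 s y| := by
  classical
  have hp : ∀ w : Pos m r → ZMod 2, 0 < seqDensity η σs Δ y w := fun w => hpos _
  have h := sum_abs_hybrid_sub_le hp (infoPos η σs Δ β m r)
  rw [← Equiv.sum_comp (bitsEquiv m r), sum_seqDensity] at h
  simp only [seqDensity, Equiv.symm_apply_apply] at h
  refine h.trans ?_
  rw [Finset.sum_filter, ← Equiv.sum_comp toLex, Fintype.sum_prod_type]
  refine Finset.sum_le_sum fun ℓ _ => ?_
  rw [Finset.sum_filter]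
  refine Finset.sum_le_sum fun i _ => ?_
  simp only [infoPos, Set.mem_ofPred_eq, ofLex_toLex]
  by_cases hi : i ∈ infoSet η σs Δ β ℓ
  · simp only [hi, not_true_eq_false, if_false, le_refl]
  · simp only [hi, not_false_eq_true, if_true]
    exact frozen_term_le η σs Δ ℓ i y

end Transform

/-! ### Densities of the test channel -/

section Coset

theorem cosetLabel_succ {r : ℕ} (b : Fin (r + 1) → ZMod 2) :
    cosetLabel b = (b 0).val + 2 * cosetLabel fun ℓ => b ℓ.succ := by
  simp only [cosetLabel, Fin.sum_univ_succ, Fin.val_zero, pow_zero, one_mul, Fin.val_succ,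
    Finset.mul_sum]
  congr 1
  refine Finset.sum_congr rfl fun ℓ _ => ?_
  ring

/-- Every integer lies in exactly one labelled coset of `2 ^ r ℤ`. -/
theorem coset_bijective (r : ℕ) :
    Function.Bijective fun p : (Fin r → ZMod 2) × ℤ => cosetLabel p.1 + 2 ^ r * p.2 := by
  induction r with
  | zero =>
    constructor
    · rintro ⟨b, z⟩ ⟨b', z'⟩ h
      simp only [cosetLabel, Finset.univ_eq_empty, Finset.sum_empty, pow_zero, one_mul,
        zero_add] at h
      rw [h, Subsingleton.elim b b']
    · intro k
      exact ⟨(Fin.elim0, k), by simp [cosetLabel]⟩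
  | succ r ih =>
    constructor
    · rintro ⟨b, z⟩ ⟨b', z'⟩ h
      simp only [cosetLabel_succ, pow_succ'] at h
      have hb := ZMod.val_lt (b 0)
      have hb' := ZMod.val_lt (b' 0)
      rw [add_assoc, add_assoc, mul_assoc, mul_assoc, ← mul_add, ← mul_add] at h
      have h0 : (b 0).val = (b' 0).val := by omega
      have h1 : cosetLabel (fun ℓ => b ℓ.succ) + 2 ^ r * z =
          cosetLabel (fun ℓ => b' ℓ.succ) + 2 ^ r * z' := by omega
      have h2 := ih.1 (a₁ := (fun ℓ => b ℓ.succ, z)) (a₂ := (fun ℓ => b' ℓ.succ, z')) h1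
      simp only [Prod.mk.injEq] at h2 ⊢
      refine ⟨funext fun ℓ => ?_, h2.2⟩
      refine Fin.cases (ZMod.val_injective 2 h0) (fun ℓ => ?_) ℓ
      exact congrFun h2.1 ℓ
    · intro k
      obtain ⟨⟨b, z⟩, hbz⟩ := ih.2 (k / 2)
      refine ⟨(Fin.cons ((k % 2 : ℤ) : ZMod 2) b, z), ?_⟩
      simp only [cosetLabel_succ, Fin.cons_zero, Fin.cons_succ, pow_succ'] at hbz ⊢
      have hv : ((((k % 2 : ℤ) : ZMod 2).val : ℕ) : ℤ) = k % 2 := by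
        rw [ZMod.val_intCast]
        simp
      rw [hv, add_assoc, mul_assoc, ← mul_add, hbz]
      omega

theorem summable_coset {r : ℕ} {F : ℤ → ℝ} (hF : Summable F) (b : Fin r → ZMod 2) :
    Summable fun z : ℤ => F (cosetLabel b + 2 ^ r * z) :=
  hF.comp_injective (i := fun z : ℤ => cosetLabel b + 2 ^ r * z) fun z z' h =>
    congrArg Prod.snd ((coset_bijective r).1 (a₁ := (b, z)) (a₂ := (b, z')) h)

theorem sum_tsum_coset {r : ℕ} {F : ℤ → ℝ} (hF : Summable F) :
    ∑ b : Fin r → ZMod 2, ∑' z : ℤ, F (cosetLabel b + 2 ^ r * z) = ∑' k, F k := by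
  have hs := (Equiv.summable_iff (Equiv.ofBijective _ (coset_bijective r))).2 hF
  rw [← (Equiv.ofBijective _ (coset_bijective r)).tsum_eq F]
  exact (hs.tsum_prod.trans (tsum_fintype _)).symm

end Coset

theorem integrable_tsum_of_nonneg {h : ℤ → ℝ → ℝ} (hm : ∀ k, Measurable (h k))
    (hi : ∀ k, Integrable (h k)) (h0 : ∀ k y, 0 ≤ h k y) (hs : Summable fun k => ∫ y, h k y)
    (hy : ∀ y, Summable fun k => h k y) :
    Integrable (fun y => ∑' k, h k y) ∧ ∫ y, ∑' k, h k y = ∑' k, ∫ y, h k y := by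
  constructor
  · refine ⟨(Measurable.tsum hm).aestronglyMeasurable, ?_⟩
    rw [hasFiniteIntegral_iff_ofReal
      (Filter.Eventually.of_forall fun y => tsum_nonneg fun k => h0 k y)]
    have e : ∀ y, ENNReal.ofReal (∑' k, h k y) = ∑' k, ENNReal.ofReal (h k y) := fun y =>
      ENNReal.ofReal_tsum_of_nonneg (fun k => h0 k y) (hy y)
    simp_rw [e]
    rw [lintegral_tsum fun k => (hm k).ennreal_ofReal.aemeasurable]
    have e' : ∀ k, ∫⁻ y, ENNReal.ofReal (h k y) = ENNReal.ofReal (∫ y, h k y) := fun k =>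
      (ofReal_integral_eq_lintegral_ofReal (hi k)
        (Filter.Eventually.of_forall fun y => h0 k y)).symm
    simp_rw [e']
    rw [← ENNReal.ofReal_tsum_of_nonneg (fun k => integral_nonneg fun y => h0 k y) hs]
    exact ENNReal.ofReal_lt_top
  · refine (integral_tsum_of_summable_integral_norm hi ?_).symm
    refine hs.congr fun k => integral_congr_ae (Filter.Eventually.of_forall fun y => ?_)
    exact (Real.norm_of_nonneg (h0 k y)).symm

section Letter

variable {η σs Δ : ℝ} {r : ℕ}

theorem measurable_letterDensity (b : Fin r → ZMod 2) : Measurable (letterDensity η σs Δ b) := by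
  unfold letterDensity
  exact Measurable.tsum fun z => (measurable_gaussianPDFReal _ _).const_mul _

theorem letterDensity_pos (hη : 0 < η) (hv : 0 < recVar σs Δ) (hΔ : 0 < Δ)
    (b : Fin r → ZMod 2) (y : ℝ) : 0 < letterDensity η σs Δ b y := by
  have h := summable_coset (summable_channel hη hv hΔ y) b
  refine h.tsum_pos (fun z => mul_nonneg (latticeGaussian_pos hη hv _).le
    (gaussianPDFReal_nonneg _ _ _)) 0 ?_
  exact mul_pos (latticeGaussian_pos hη hv _) (gaussianPDFReal_pos _ _ _ (by simpa using hΔ))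

theorem sum_letterDensity (hη : 0 < η) (hv : 0 < recVar σs Δ) (hΔ : 0 < Δ) (y : ℝ) :
    ∑ b : Fin r → ZMod 2, letterDensity η σs Δ b y =
      ∑' k : ℤ, latticeGaussian η σs Δ k * gaussianPDFReal (η * k) Δ.toNNReal y :=
  sum_tsum_coset (summable_channel hη hv hΔ y)

theorem letterDensity_integral (hη : 0 < η) (hv : 0 < recVar σs Δ) (hΔ : 0 < Δ)
    (b : Fin r → ZMod 2) :
    Integrable (letterDensity η σs Δ b) ∧ ∫ y, letterDensity η σs Δ b y =
      ∑' z : ℤ, latticeGaussian η σs Δ (cosetLabel b + 2 ^ r * z) := by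
  have hne : Δ.toNNReal ≠ 0 := by simpa using hΔ
  have hint : ∀ z : ℤ, ∫ y, latticeGaussian η σs Δ (cosetLabel b + 2 ^ r * z) *
      gaussianPDFReal (η * ((cosetLabel b + 2 ^ r * z : ℤ) : ℝ)) Δ.toNNReal y =
      latticeGaussian η σs Δ (cosetLabel b + 2 ^ r * z) := fun z => by
    rw [integral_const_mul, integral_gaussianPDFReal_eq_one _ hne, mul_one]
  have h := integrable_tsum_of_nonneg
    (h := fun z y => latticeGaussian η σs Δ (cosetLabel b + 2 ^ r * z) *
      gaussianPDFReal (η * ((cosetLabel b + 2 ^ r * z : ℤ) : ℝ)) Δ.toNNReal y)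
    (fun z => (measurable_gaussianPDFReal _ _).const_mul _)
    (fun z => (integrable_gaussianPDFReal _ _).const_mul _)
    (fun z y => mul_nonneg (latticeGaussian_pos hη hv _).le (gaussianPDFReal_nonneg _ _ _))
    (by simp_rw [hint]; exact summable_coset (summable_latticeGaussian hη hv) b)
    (fun y => summable_coset (summable_channel hη hv hΔ y) b)
  simp_rw [hint] at h
  exact h

theorem integral_sum_letterDensity (hη : 0 < η) (hv : 0 < recVar σs Δ) (hΔ : 0 < Δ) :
    ∫ y, ∑ b : Fin r → ZMod 2, letterDensity η σs Δ b y = 1 := by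
  rw [integral_finsetSum _ fun b _ => (letterDensity_integral hη hv hΔ b).1]
  simp_rw [(letterDensity_integral hη hv hΔ _).2]
  rw [sum_tsum_coset (summable_latticeGaussian hη hv), tsum_latticeGaussian hη hv]

/-- The squared error between `α y` and the nearest point of the coset labelled by `b`. -/
def cellError (η σs Δ : ℝ) (b : Fin r → ZMod 2) (y : ℝ) : ℝ :=
  (mmseScale σs Δ * y - (η * cosetLabel b +
    2 ^ r * η * round ((mmseScale σs Δ * y - η * cosetLabel b) / (2 ^ r * η)))) ^ 2

theorem cellError_nonneg (b : Fin r → ZMod 2) (y : ℝ) : 0 ≤ cellError η σs Δ b y := sq_nonneg _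

theorem measurable_cellError (b : Fin r → ZMod 2) : Measurable (cellError η σs Δ b) := by
  have h : Measurable (fun x : ℝ => ((round x : ℤ) : ℝ)) := by
    simp_rw [round_eq]
    exact (measurable_from_top (f := fun z : ℤ => (z : ℝ))).comp
      (Int.measurable_floor.comp (measurable_id.add_const _))
  unfold cellError
  exact ((measurable_id.const_mul _).sub (measurable_const.add (measurable_const.mul (h.comp
    (((measurable_id.const_mul _).sub_const _).div_const _))))).pow_const 2

theorem cellError_eq (hη : 0 < η) (b : Fin r → ZMod 2) (y : ℝ) :
    cellError η σs Δ b y = (2 ^ r * η) ^ 2 *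
      |(mmseScale σs Δ * y - η * cosetLabel b) / (2 ^ r * η) -
        round ((mmseScale σs Δ * y - η * cosetLabel b) / (2 ^ r * η))| ^ 2 := by
  rw [sq_abs, ← mul_pow, cellError, mul_sub, mul_div_cancel₀ _ (by positivity : 2 ^ r * η ≠ 0)]
  ring

theorem cellError_le (hη : 0 < η) (b : Fin r → ZMod 2) (y : ℝ) :
    cellError η σs Δ b y ≤ (2 ^ r * η) ^ 2 / 4 := by
  rw [cellError_eq hη]
  have h := abs_sub_round ((mmseScale σs Δ * y - η * cosetLabel b) / (2 ^ r * η))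
  have h2 := pow_le_pow_left₀ (abs_nonneg _) h 2
  have h3 : (0 : ℝ) ≤ (2 ^ r * η) ^ 2 := by positivity
  nlinarith

theorem cellError_le_point (hη : 0 < η) (b : Fin r → ZMod 2) (y : ℝ) (z : ℤ) :
    cellError η σs Δ b y ≤
      (mmseScale σs Δ * y - η * ((cosetLabel b + 2 ^ r * z : ℤ) : ℝ)) ^ 2 := by
  rw [cellError_eq hη]
  have h := round_le ((mmseScale σs Δ * y - η * cosetLabel b) / (2 ^ r * η)) z
  have h2 := pow_le_pow_left₀ (abs_nonneg _) h 2
  calc _ ≤ (2 ^ r * η) ^ 2 *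
        |(mmseScale σs Δ * y - η * cosetLabel b) / (2 ^ r * η) - z| ^ 2 := by gcongr
    _ = _ := by
      rw [sq_abs, ← mul_pow, mul_sub, mul_div_cancel₀ _ (by positivity : 2 ^ r * η ≠ 0)]
      push_cast
      ring

theorem integrable_cellError_mul (hη : 0 < η) (hv : 0 < recVar σs Δ) (hΔ : 0 < Δ)
    (b : Fin r → ZMod 2) :
    Integrable fun y => cellError η σs Δ b y * letterDensity η σs Δ b y := by
  refine (letterDensity_integral hη hv hΔ b).1.bdd_mul (c := (2 ^ r * η) ^ 2 / 4)
    (measurable_cellError b).aestronglyMeasurable (Filter.Eventually.of_forall fun y => ?_)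
  rw [Real.norm_of_nonneg (cellError_nonneg b y)]
  exact cellError_le hη b y

/-- Over the test channel, the error of the reconstruction from the coset label is at most that of
the channel input itself, which is a point of this coset. -/
theorem integral_cellError_le (hη : 0 < η) (hσs : 0 < σs) (hv : 0 < recVar σs Δ) (hΔ : 0 < Δ) :
    ∫ y, ∑ b : Fin r → ZMod 2, cellError η σs Δ b y * letterDensity η σs Δ b y ≤
      mmseVar σs Δ := by
  set α := mmseScale σs Δ with hα
  set H : ℤ → ℝ → ℝ := fun k y => latticeGaussian η σs Δ k *
    ((α * y - η * k) ^ 2 * gaussianPDFReal (η * k) Δ.toNNReal y) with hH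
  have hlat := fun k => (latticeGaussian_pos hη hv k).le
  have hH0 : ∀ k y, 0 ≤ H k y := fun k y =>
    mul_nonneg (hlat k) (mul_nonneg (sq_nonneg _) (gaussianPDFReal_nonneg _ _ _))
  have hHint : ∀ k, ∫ y, H k y =
      (α - 1) ^ 2 * ((η * k) ^ 2 * latticeGaussian η σs Δ k) +
        α ^ 2 * Δ * latticeGaussian η σs Δ k := fun k => by
    simp only [hH]
    rw [integral_const_mul, (integral_sq_mul_gaussianPDFReal hΔ α (η * k)).2]
    ring
  have hs1 := (summable_sq_mul_latticeGaussian hη hv).mul_left ((α - 1) ^ 2)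
  have hs2 := (summable_latticeGaussian hη hv).mul_left (α ^ 2 * Δ)
  have hHy : ∀ y, Summable fun k => H k y := fun y => by
    refine Summable.of_nonneg_of_le (fun k => hH0 k y) (fun k => ?_)
      ((((summable_latticeGaussian hη hv).mul_left (2 * (α * y) ^ 2)).add
        ((summable_sq_mul_latticeGaussian hη hv).mul_left 2)).mul_right (√(2 * Real.pi * Δ))⁻¹)
    have h1 : (α * y - η * k) ^ 2 ≤ 2 * (α * y) ^ 2 + 2 * (η * k) ^ 2 := by
      nlinarith [sq_nonneg (α * y + η * k)]
    calc H k y ≤ latticeGaussian η σs Δ k *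
          ((2 * (α * y) ^ 2 + 2 * (η * k) ^ 2) * (√(2 * Real.pi * Δ))⁻¹) :=
          mul_le_mul_of_nonneg_left (mul_le_mul h1 (gaussianPDFReal_le hΔ _ _)
            (gaussianPDFReal_nonneg _ _ _) (by positivity)) (hlat k)
      _ = _ := by ring
  have hmain := integrable_tsum_of_nonneg (h := H)
    (fun k => (((measurable_id.const_mul α).sub_const _).pow_const 2 |>.mul
      (measurable_gaussianPDFReal _ _)).const_mul _)
    (fun k => ((integral_sq_mul_gaussianPDFReal hΔ α (η * k)).1).const_mul _)
    hH0 (by simp_rw [hHint]; exact hs1.add hs2) hHy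
  calc ∫ y, ∑ b : Fin r → ZMod 2, cellError η σs Δ b y * letterDensity η σs Δ b y
      ≤ ∫ y, ∑' k, H k y := by
        refine integral_mono (integrable_finsetSum _ fun b _ =>
          integrable_cellError_mul hη hv hΔ b) hmain.1 fun y => ?_
        rw [← sum_tsum_coset (r := r) (hHy y)]
        refine Finset.sum_le_sum fun b _ => ?_
        rw [letterDensity, ← tsum_mul_left]
        refine ((summable_coset (summable_channel hη hv hΔ y) b).mul_left _).tsum_le_tsum
          (fun z => ?_) (summable_coset (hHy y) b)
        rw [hH, mul_left_comm]
        exact mul_le_mul_of_nonneg_left (mul_le_mul_of_nonneg_right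
          (cellError_le_point hη b y z) (gaussianPDFReal_nonneg _ _ _)) (hlat _)
    _ = (α - 1) ^ 2 * ∑' k : ℤ, (η * k) ^ 2 * latticeGaussian η σs Δ k + α ^ 2 * Δ := by
        rw [hmain.2]
        simp_rw [hHint]
        rw [hs1.tsum_add hs2, tsum_mul_left, tsum_mul_left, tsum_latticeGaussian hη hv, mul_one]
    _ ≤ (α - 1) ^ 2 * recVar σs Δ + α ^ 2 * Δ := by
        gcongr
        exact tsum_sq_mul_latticeGaussian_le hη hv
    _ = mmseVar σs Δ := by
        have : Δ = σs ^ 2 - recVar σs Δ := by rw [recVar]; ring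
        rw [hα, mmseScale, mmseVar]
        generalize recVar σs Δ = v at *
        subst this
        field_simp
        ring

end Letter

section Block

variable {η σs Δ : ℝ} {m r : ℕ}

/-- A sum over all bit arrays of a product over the coordinates, each factor of which depends on the
label of one coordinate only, is a product of sums. -/
theorem sum_bits_prod (F : Fin (2 ^ m) → (Fin r → ZMod 2) → ℝ) :
    ∑ x : Bits m r, ∏ j, F j (fun ℓ => x ℓ j) = ∏ j, ∑ b, F j b := by
  rw [Fintype.prod_sum, ← Equiv.sum_comp (Equiv.piComm _)]
  rfl

theorem measurable_blockDensity (x : Bits m r) : Measurable (blockDensity η σs Δ x) :=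
  Finset.measurable_prod _ fun i _ => (measurable_letterDensity _).comp (measurable_pi_apply i)

theorem blockDensity_pos (hη : 0 < η) (hv : 0 < recVar σs Δ) (hΔ : 0 < Δ) (x : Bits m r)
    (y : Fin (2 ^ m) → ℝ) : 0 < blockDensity η σs Δ x y :=
  Finset.prod_pos fun _ _ => letterDensity_pos hη hv hΔ _ _

theorem integrable_blockDensity (hη : 0 < η) (hv : 0 < recVar σs Δ) (hΔ : 0 < Δ)
    (x : Bits m r) : Integrable (blockDensity η σs Δ x) :=
  Integrable.fintype_prod fun _ => (letterDensity_integral hη hv hΔ _).1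

theorem sum_blockDensity (y : Fin (2 ^ m) → ℝ) :
    ∑ x : Bits m r, blockDensity η σs Δ x y =
      ∏ j, ∑ b : Fin r → ZMod 2, letterDensity η σs Δ b (y j) :=
  sum_bits_prod fun j b => letterDensity η σs Δ b (y j)

theorem integral_sum_blockDensity (hη : 0 < η) (hv : 0 < recVar σs Δ) (hΔ : 0 < Δ) :
    ∫ y, ∑ x : Bits m r, blockDensity η σs Δ x y = 1 := by
  simp_rw [sum_blockDensity]
  rw [integral_fintype_prod_volume_eq_prod
    (f := fun (_ : Fin (2 ^ m)) t => ∑ b : Fin r → ZMod 2, letterDensity η σs Δ b t)]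
  simp [integral_sum_letterDensity hη hv hΔ]

theorem integrable_blockError (hη : 0 < η) (hv : 0 < recVar σs Δ) (hΔ : 0 < Δ)
    (x : Bits m r) (i : Fin (2 ^ m)) :
    Integrable fun y : Fin (2 ^ m) → ℝ =>
      cellError η σs Δ (fun ℓ => x ℓ i) (y i) * blockDensity η σs Δ x y := by
  refine (integrable_blockDensity hη hv hΔ x).bdd_mul (c := (2 ^ r * η) ^ 2 / 4)
    ((measurable_cellError _).comp (measurable_pi_apply i)).aestronglyMeasurable
    (Filter.Eventually.of_forall fun y => ?_)
  rw [Real.norm_of_nonneg (cellError_nonneg _ _)]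
  exact cellError_le hη _ _

theorem integral_blockError_le (hη : 0 < η) (hσs : 0 < σs) (hv : 0 < recVar σs Δ) (hΔ : 0 < Δ)
    (i : Fin (2 ^ m)) :
    ∫ y : Fin (2 ^ m) → ℝ, ∑ x : Bits m r,
      cellError η σs Δ (fun ℓ => x ℓ i) (y i) * blockDensity η σs Δ x y ≤ mmseVar σs Δ := by
  set F : Fin (2 ^ m) → (Fin r → ZMod 2) → ℝ → ℝ := fun j b t =>
    (if j = i then cellError η σs Δ b t else 1) * letterDensity η σs Δ b t with hF
  have e : ∀ y : Fin (2 ^ m) → ℝ, ∑ x : Bits m r,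
      cellError η σs Δ (fun ℓ => x ℓ i) (y i) * blockDensity η σs Δ x y =
      ∏ j, ∑ b, F j b (y j) := fun y => by
    rw [← sum_bits_prod fun j b => F j b (y j)]
    refine Finset.sum_congr rfl fun x _ => ?_
    simp only [hF]
    rw [Finset.prod_mul_distrib, Finset.prod_ite_eq' Finset.univ i
      (fun j => cellError η σs Δ (fun ℓ => x ℓ j) (y j)), if_pos (Finset.mem_univ _)]
    rfl
  simp_rw [e]
  rw [integral_fintype_prod_volume_eq_prod (f := fun j t => ∑ b, F j b t),
    Finset.prod_eq_single i]
  · simp only [hF, if_true]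
    exact integral_cellError_le hη hσs hv hΔ
  · intro j _ hj
    simp only [hF, if_neg hj, one_mul]
    exact integral_sum_letterDensity hη hv hΔ
  · simp

theorem sum_bitDensity (ℓ : Fin r) (i : Fin (2 ^ m)) (y : Fin (2 ^ m) → ℝ) :
    ∑ s : Past m r ℓ i, (bitDensity η σs Δ ℓ i 0 s y + bitDensity η σs Δ ℓ i 1 s y) =
      ∑ x : Bits m r, blockDensity η σs Δ x y := by
  have h : ∀ s : Past m r ℓ i, bitDensity η σs Δ ℓ i 0 s y + bitDensity η σs Δ ℓ i 1 s y =
      ∑ v : ZMod 2, bitDensity η σs Δ ℓ i v s y := fun s =>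
    (Fin.sum_univ_two (fun v : ZMod 2 => bitDensity η σs Δ ℓ i v s y)).symm
  simp_rw [h]
  rw [← Fintype.sum_prod_type' (f := fun (s : Past m r ℓ i) (v : ZMod 2) =>
    bitDensity η σs Δ ℓ i v s y), ← Finset.sum_fiberwise Finset.univ
    (fun x : Bits m r => (past ℓ i x (transform x), transform x ℓ i))]
  refine Finset.sum_congr rfl fun p _ => ?_
  simp only [bitDensity, Prod.ext_iff]

theorem bitDensity_nonneg (hη : 0 < η) (hv : 0 < recVar σs Δ) (hΔ : 0 < Δ) (ℓ : Fin r)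
    (i : Fin (2 ^ m)) (v : ZMod 2) (s : Past m r ℓ i) (y : Fin (2 ^ m) → ℝ) :
    0 ≤ bitDensity η σs Δ ℓ i v s y :=
  Finset.sum_nonneg fun _ _ => (blockDensity_pos hη hv hΔ _ _).le

theorem integrable_bitDensity (hη : 0 < η) (hv : 0 < recVar σs Δ) (hΔ : 0 < Δ) (ℓ : Fin r)
    (i : Fin (2 ^ m)) (v : ZMod 2) (s : Past m r ℓ i) :
    Integrable (bitDensity η σs Δ ℓ i v s) :=
  integrable_finsetSum _ fun x _ => integrable_blockDensity hη hv hΔ x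

theorem measurable_bitDensity (ℓ : Fin r) (i : Fin (2 ^ m)) (v : ZMod 2) (s : Past m r ℓ i) :
    Measurable (bitDensity η σs Δ ℓ i v s) :=
  Finset.measurable_sum _ fun x _ => measurable_blockDensity x

theorem two_mul_sqrt_mul_le {p q : ℝ} (hp : 0 ≤ p) (hq : 0 ≤ q) : 2 * √(p * q) ≤ p + q := by
  rw [Real.sqrt_mul hp]
  nlinarith [sq_nonneg (√p - √q), Real.sq_sqrt hp, Real.sq_sqrt hq]

/-- The factorization `p - q = (√p - √q) (√p + √q)` and the inequality of the means. -/
theorem abs_sub_le_sqrt {p q τ : ℝ} (hp : 0 ≤ p) (hq : 0 ≤ q) (hτ : 0 < τ) :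
    |p - q| ≤ (τ * (p + q - 2 * √(p * q)) + (p + q + 2 * √(p * q)) / τ) / 2 := by
  have e : p - q = (√p - √q) * (√p + √q) := by
    nlinarith [Real.sq_sqrt hp, Real.sq_sqrt hq]
  have e1 : p + q - 2 * √(p * q) = |√p - √q| ^ 2 := by
    rw [Real.sqrt_mul hp, sq_abs]; nlinarith [Real.sq_sqrt hp, Real.sq_sqrt hq]
  have e2 : p + q + 2 * √(p * q) = (√p + √q) ^ 2 := by
    rw [Real.sqrt_mul hp]; nlinarith [Real.sq_sqrt hp, Real.sq_sqrt hq]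
  have hb : 0 ≤ √p + √q := by positivity
  rw [e, abs_mul, abs_of_nonneg hb, e1, e2]
  generalize |√p - √q| = a
  generalize √p + √q = b at *
  rw [le_div_iff₀ two_pos, ← sub_nonneg]
  have : τ * a ^ 2 + b ^ 2 / τ - a * b * 2 = (τ * a - b) ^ 2 / τ := by field_simp; ring
  rw [this]
  positivity

theorem integrable_sqrt_bitDensity (hη : 0 < η) (hv : 0 < recVar σs Δ) (hΔ : 0 < Δ) (ℓ : Fin r)
    (i : Fin (2 ^ m)) (s : Past m r ℓ i) :
    Integrable fun y => √(bitDensity η σs Δ ℓ i 0 s y * bitDensity η σs Δ ℓ i 1 s y) := by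
  refine ((integrable_bitDensity hη hv hΔ ℓ i 0 s).add
    (integrable_bitDensity hη hv hΔ ℓ i 1 s)).mono'
    ((measurable_bitDensity ℓ i 0 s).mul (measurable_bitDensity ℓ i 1 s)).sqrt.aestronglyMeasurable
    (Filter.Eventually.of_forall fun y => ?_)
  rw [Real.norm_of_nonneg (Real.sqrt_nonneg _)]
  have := two_mul_sqrt_mul_le (bitDensity_nonneg hη hv hΔ ℓ i 0 s y)
    (bitDensity_nonneg hη hv hΔ ℓ i 1 s y)
  have := Real.sqrt_nonneg (bitDensity η σs Δ ℓ i 0 s y * bitDensity η σs Δ ℓ i 1 s y)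
  simp only [Pi.add_apply]
  linarith

theorem integrable_abs_bitDensity (hη : 0 < η) (hv : 0 < recVar σs Δ) (hΔ : 0 < Δ) (ℓ : Fin r)
    (i : Fin (2 ^ m)) (s : Past m r ℓ i) :
    Integrable fun y => |bitDensity η σs Δ ℓ i 0 s y - bitDensity η σs Δ ℓ i 1 s y| :=
  ((integrable_bitDensity hη hv hΔ ℓ i 0 s).sub (integrable_bitDensity hη hv hΔ ℓ i 1 s)).abs

/-- A bit whose Bhattacharyya parameter is at least `1 - δ` is close to uniform given its past. -/
theorem integral_abs_bitDensity_le (hη : 0 < η) (hv : 0 < recVar σs Δ) (hΔ : 0 < Δ) (ℓ : Fin r)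
    (i : Fin (2 ^ m)) {δ : ℝ} (hδ : 0 < δ) (hZ : 1 - δ ≤ bhattacharyya η σs Δ ℓ i) :
    ∫ y, ∑ s : Past m r ℓ i, |bitDensity η σs Δ ℓ i 0 s y - bitDensity η σs Δ ℓ i 1 s y| ≤
      √(2 * δ) := by
  set A : (Fin (2 ^ m) → ℝ) → ℝ := fun y => ∑ x : Bits m r, blockDensity η σs Δ x y with hA
  set B : (Fin (2 ^ m) → ℝ) → ℝ := fun y => ∑ s : Past m r ℓ i,
    2 * √(bitDensity η σs Δ ℓ i 0 s y * bitDensity η σs Δ ℓ i 1 s y) with hB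
  have hAi : Integrable A := integrable_finsetSum _ fun x _ => integrable_blockDensity hη hv hΔ x
  have hBi : Integrable B := integrable_finsetSum _ fun s _ =>
    (integrable_sqrt_bitDensity hη hv hΔ ℓ i s).const_mul 2
  have hA1 : ∫ y, A y = 1 := integral_sum_blockDensity hη hv hΔ
  have hBZ : ∫ y, B y = bhattacharyya η σs Δ ℓ i := by
    rw [hB, integral_finsetSum _ fun s _ =>
      (integrable_sqrt_bitDensity hη hv hΔ ℓ i s).const_mul 2, bhattacharyya, Finset.mul_sum]
    simp_rw [integral_const_mul]
  have hn := bitDensity_nonneg (m := m) (r := r) hη hv hΔ ℓ i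
  have hZ1 : bhattacharyya η σs Δ ℓ i ≤ 1 := by
    rw [← hBZ, ← hA1]
    refine integral_mono hBi hAi fun y => ?_
    simp only [hA, hB]
    rw [← sum_bitDensity ℓ i]
    exact Finset.sum_le_sum fun s _ => two_mul_sqrt_mul_le (hn 0 s y) (hn 1 s y)
  -- This choice makes the two terms of the inequality of the means equal.
  set τ := √(2 / δ) with hτ
  have hτ0 : 0 < τ := by positivity
  have e1 : τ * δ = √(2 * δ) := by
    have : δ = √(δ ^ 2) := (Real.sqrt_sq hδ.le).symm
    rw [hτ]
    nth_rewrite 2 [this]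
    rw [← Real.sqrt_mul (by positivity)]
    congr 1
    field_simp
  have e2 : 2 / τ = √(2 * δ) := by
    rw [← e1, div_eq_iff hτ0.ne', mul_right_comm, hτ, Real.mul_self_sqrt (by positivity)]
    field_simp
  calc ∫ y, ∑ s : Past m r ℓ i, |bitDensity η σs Δ ℓ i 0 s y - bitDensity η σs Δ ℓ i 1 s y|
      ≤ ∫ y, (τ * (A y - B y) + (A y + B y) / τ) / 2 := by
        refine integral_mono (integrable_finsetSum _ fun s _ =>
          integrable_abs_bitDensity hη hv hΔ ℓ i s)
          ((((hAi.sub hBi).const_mul τ).add ((hAi.add hBi).div_const τ)).div_const 2) fun y => ?_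
        simp only [hA, hB]
        rw [← sum_bitDensity ℓ i, ← Finset.sum_sub_distrib, ← Finset.sum_add_distrib,
          Finset.mul_sum, Finset.sum_div, ← Finset.sum_add_distrib, Finset.sum_div]
        exact Finset.sum_le_sum fun s _ => abs_sub_le_sqrt (hn 0 s y) (hn 1 s y) hτ0
    _ = (τ * (1 - bhattacharyya η σs Δ ℓ i) + (1 + bhattacharyya η σs Δ ℓ i) / τ) / 2 := by
        have h1 : Integrable fun y => τ * (A y - B y) := (hAi.sub hBi).const_mul τ
        have h2 : Integrable fun y => (A y + B y) / τ := (hAi.add hBi).div_const τ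
        rw [integral_div, integral_add h1 h2,
          integral_const_mul, integral_div, integral_sub hAi hBi, integral_add hAi hBi, hA1, hBZ]
    _ ≤ (τ * δ + 2 / τ) / 2 := by
        gcongr <;> linarith
    _ = √(2 * δ) := by rw [e1, e2]; ring

end Block

/-! ### The distortion of the quantizer -/

section Assembly

variable {η σs Δ : ℝ} {m r : ℕ}

/-- The density of the source vector. -/
def sourceDensity (m : ℕ) (σs : ℝ) (y : Fin (2 ^ m) → ℝ) : ℝ :=
  ∏ i, gaussianPDFReal 0 (σs ^ 2).toNNReal (y i)

theorem sourceDensity_nonneg (y : Fin (2 ^ m) → ℝ) : 0 ≤ sourceDensity m σs y :=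
  Finset.prod_nonneg fun _ _ => gaussianPDFReal_nonneg _ _ _

theorem measurable_sourceDensity : Measurable (sourceDensity m σs) :=
  Finset.measurable_prod _ fun i _ =>
    (measurable_gaussianPDFReal _ _).comp (measurable_pi_apply i)

theorem source_eq_withDensity (hσs : 0 < σs) :
    source m σs = volume.withDensity fun y => ENNReal.ofReal (sourceDensity m σs y) := by
  have hne : (σs ^ 2).toNNReal ≠ 0 := by simpa using hσs.ne'
  set φ := gaussianPDFReal 0 (σs ^ 2).toNNReal with hφ
  refine Measure.pi_eq fun s hs => ?_
  have hi : ∀ i, Integrable ((s i).indicator φ) := fun i =>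
    (integrable_gaussianPDFReal _ _).indicator (hs i)
  have h0 : ∀ i t, 0 ≤ (s i).indicator φ t := fun i t =>
    Set.indicator_nonneg (fun _ _ => gaussianPDFReal_nonneg _ _ _) t
  have e : ∀ y : Fin (2 ^ m) → ℝ,
      (Set.univ.pi s).indicator (fun y => ENNReal.ofReal (sourceDensity m σs y)) y =
        ENNReal.ofReal (∏ i, (s i).indicator φ (y i)) := fun y => by
    by_cases hy : y ∈ Set.univ.pi s
    · rw [Set.indicator_of_mem hy, sourceDensity]
      congr 1
      exact Finset.prod_congr rfl fun i _ => (Set.indicator_of_mem (hy i trivial) φ).symm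
    · rw [Set.indicator_of_notMem hy]
      simp only [Set.mem_pi, Set.mem_univ, true_imp_iff, not_forall] at hy
      obtain ⟨i, hyi⟩ := hy
      rw [Finset.prod_eq_zero (Finset.mem_univ i) (Set.indicator_of_notMem hyi φ),
        ENNReal.ofReal_zero]
  rw [withDensity_apply _ (MeasurableSet.univ_pi hs),
    ← lintegral_indicator (MeasurableSet.univ_pi hs)]
  simp_rw [e]
  have hi' : Integrable fun y : Fin (2 ^ m) → ℝ => ∏ i, (s i).indicator φ (y i) :=
    Integrable.fintype_prod hi
  rw [← ofReal_integral_eq_lintegral_ofReal hi'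
    (Filter.Eventually.of_forall fun y => Finset.prod_nonneg fun i _ => h0 i (y i)),
    integral_fintype_prod_volume_eq_prod (f := fun i => (s i).indicator φ),
    ENNReal.ofReal_prod_of_nonneg fun i _ => integral_nonneg (h0 i)]
  refine Finset.prod_congr rfl fun i _ => ?_
  rw [gaussianReal_apply_eq_integral _ hne, integral_indicator (hs i)]

theorem distortion_reconstruct (u : Bits m r) (y : Fin (2 ^ m) → ℝ) :
    distortion σs Δ (reconstruct η σs Δ u y, y) =
      ∑ i, cellError η σs Δ (fun ℓ => transform u ℓ i) (y i) := rfl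

theorem distortion_nonneg (p : (Fin (2 ^ m) → ℝ) × (Fin (2 ^ m) → ℝ)) :
    0 ≤ distortion σs Δ p :=
  Finset.sum_nonneg fun _ _ => sq_nonneg _

theorem measurable_distortion :
    Measurable (distortion (m := m) σs Δ) := by
  unfold distortion
  fun_prop

/-- The probability that the quantizer chooses the bits `u`, averaged over the frozen bits. -/
def meanQuantizerProb (η σs Δ β : ℝ) (u : Bits m r) (y : Fin (2 ^ m) → ℝ) : ℝ :=
  ∏ k, hybridCond (seqDensity η σs Δ y) (infoPos η σs Δ β m r) k (bitsEquiv m r u)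

theorem meanQuantizerProb_eq (β : ℝ) (u : Bits m r) (y : Fin (2 ^ m) → ℝ) :
    meanQuantizerProb η σs Δ β u y =
      ∑ ubar : Bits m r, (Fintype.card (Bits m r) : ℝ)⁻¹ * quantizerProb η σs Δ β ubar u y := by
  rw [← Finset.mul_sum, average_quantizerProb, inv_mul_cancel_left₀ (by simp)]
  rfl

theorem quantizerProb_nonneg (hη : 0 < η) (hv : 0 < recVar σs Δ) (hΔ : 0 < Δ) (β : ℝ)
    (ubar u : Bits m r) (y : Fin (2 ^ m) → ℝ) : 0 ≤ quantizerProb η σs Δ β ubar u y := by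
  have hn := bitDensity_nonneg (m := m) (r := r) hη hv hΔ
  refine Finset.prod_nonneg fun ℓ _ => Finset.prod_nonneg fun i _ => ?_
  split_ifs
  · exact div_nonneg (hn _ _ _ _ _) (add_nonneg (hn _ _ _ _ _) (hn _ _ _ _ _))
  · exact zero_le_one
  · exact le_rfl

theorem isCond_quantizer (hη : 0 < η) (hv : 0 < recVar σs Δ) (hΔ : 0 < Δ) (β : ℝ)
    (y : Fin (2 ^ m) → ℝ) :
    IsCond (hybridCond (seqDensity η σs Δ y) (infoPos η σs Δ β m r)) :=
  isCond_hybridCond (fun _ => blockDensity_pos hη hv hΔ _ _) _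

theorem meanQuantizerProb_nonneg (hη : 0 < η) (hv : 0 < recVar σs Δ) (hΔ : 0 < Δ) (β : ℝ)
    (u : Bits m r) (y : Fin (2 ^ m) → ℝ) : 0 ≤ meanQuantizerProb η σs Δ β u y :=
  Finset.prod_nonneg fun k _ => (isCond_quantizer hη hv hΔ β y).nonneg k _

theorem sum_meanQuantizerProb (hη : 0 < η) (hv : 0 < recVar σs Δ) (hΔ : 0 < Δ) (β : ℝ)
    (y : Fin (2 ^ m) → ℝ) : ∑ u : Bits m r, meanQuantizerProb η σs Δ β u y = 1 := by
  rw [← (isCond_quantizer (r := r) hη hv hΔ β y).sum_prod, ← Equiv.sum_comp (bitsEquiv m r)]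
  rfl

theorem lintegral_distortion_jointLaw (hη : 0 < η) (hσs : 0 < σs) (hv : 0 < recVar σs Δ)
    (hΔ : 0 < Δ) (β : ℝ) :
    ∫⁻ p, ENNReal.ofReal (distortion σs Δ p) ∂(jointLaw m r η σs Δ β) =
      ∫⁻ y, ENNReal.ofReal (sourceDensity m σs y * ∑ u : Bits m r,
        meanQuantizerProb η σs Δ β u y * distortion σs Δ (reconstruct η σs Δ u y, y)) := by
  have hD := measurable_distortion (m := m) (σs := σs) (Δ := Δ)
  have hDu : ∀ u : Bits m r, Measurable fun y => distortion σs Δ (reconstruct η σs Δ u y, y) :=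
    fun u => hD.comp ((measurable_reconstruct η σs Δ u).prodMk measurable_id)
  have hQ := measurable_quantizerProb (m := m) (r := r) η σs Δ β
  have hcard : (Fintype.card (Bits m r) : ENNReal)⁻¹ =
      ENNReal.ofReal (Fintype.card (Bits m r) : ℝ)⁻¹ := by
    rw [ENNReal.ofReal_inv_of_pos (by exact_mod_cast Fintype.card_pos), ENNReal.ofReal_natCast]
  have h1 : ∀ ubar u : Bits m r,
      ∫⁻ p, ENNReal.ofReal (distortion σs Δ p) ∂((Fintype.card (Bits m r) : ENNReal)⁻¹ •
        ((source m σs).withDensity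
          (fun y => ENNReal.ofReal (quantizerProb η σs Δ β ubar u y))).map
            (fun y => (reconstruct η σs Δ u y, y))) =
      ∫⁻ y, ENNReal.ofReal ((Fintype.card (Bits m r) : ℝ)⁻¹ * quantizerProb η σs Δ β ubar u y *
        distortion σs Δ (reconstruct η σs Δ u y, y)) ∂(source m σs) := by
    intro ubar u
    have hpair : Measurable fun y => (reconstruct η σs Δ u y, y) :=
      (measurable_reconstruct η σs Δ u).prodMk measurable_id
    rw [lintegral_smul_measure, lintegral_map hD.ennreal_ofReal hpair,
      lintegral_withDensity_eq_lintegral_mul _ (hQ ubar u).ennreal_ofReal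
        (hDu u).ennreal_ofReal, smul_eq_mul,
      ← lintegral_const_mul _ ((hQ ubar u).ennreal_ofReal.mul (hDu u).ennreal_ofReal)]
    refine lintegral_congr fun y => ?_
    rw [hcard, Pi.mul_apply, ← ENNReal.ofReal_mul (quantizerProb_nonneg hη hv hΔ β ubar u y),
      ← ENNReal.ofReal_mul (by positivity), mul_assoc]
  have hm : ∀ ubar u : Bits m r, Measurable fun y => ENNReal.ofReal
      ((Fintype.card (Bits m r) : ℝ)⁻¹ * quantizerProb η σs Δ β ubar u y *
        distortion σs Δ (reconstruct η σs Δ u y, y)) := fun ubar u =>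
    (((hQ ubar u).const_mul _).mul (hDu u)).ennreal_ofReal
  have h0 : ∀ (ubar u : Bits m r) (y : Fin (2 ^ m) → ℝ),
      0 ≤ (Fintype.card (Bits m r) : ℝ)⁻¹ * quantizerProb η σs Δ β ubar u y *
        distortion σs Δ (reconstruct η σs Δ u y, y) := fun ubar u y =>
    mul_nonneg (mul_nonneg (by positivity) (quantizerProb_nonneg hη hv hΔ β ubar u y))
      (distortion_nonneg _)
  rw [jointLaw, lintegral_finsetSum_measure]
  simp_rw [lintegral_finsetSum_measure, h1]
  have h2 : ∀ ubar : Bits m r, ∑ u : Bits m r, ∫⁻ y, ENNReal.ofReal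
      ((Fintype.card (Bits m r) : ℝ)⁻¹ * quantizerProb η σs Δ β ubar u y *
        distortion σs Δ (reconstruct η σs Δ u y, y)) ∂(source m σs) =
      ∫⁻ y, ∑ u : Bits m r, ENNReal.ofReal
      ((Fintype.card (Bits m r) : ℝ)⁻¹ * quantizerProb η σs Δ β ubar u y *
        distortion σs Δ (reconstruct η σs Δ u y, y)) ∂(source m σs) := fun ubar =>
    (lintegral_finsetSum _ fun u _ => hm ubar u).symm
  simp_rw [h2]
  rw [← lintegral_finsetSum _ fun ubar _ => Finset.measurable_sum _ fun u _ => hm ubar u,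
    source_eq_withDensity hσs, lintegral_withDensity_eq_lintegral_mul _
      measurable_sourceDensity.ennreal_ofReal
      (Finset.measurable_sum _ fun ubar _ => Finset.measurable_sum _ fun u _ => hm ubar u)]
  refine lintegral_congr fun y => ?_
  rw [Pi.mul_apply, ENNReal.ofReal_mul (sourceDensity_nonneg y), Finset.sum_comm,
    ENNReal.ofReal_sum_of_nonneg fun u _ => mul_nonneg
      (meanQuantizerProb_nonneg hη hv hΔ β u y) (distortion_nonneg _)]
  congr 1
  refine Finset.sum_congr rfl fun u _ => ?_
  rw [← ENNReal.ofReal_sum_of_nonneg fun ubar _ => h0 ubar u y, meanQuantizerProb_eq,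
    Finset.sum_mul]

/-- The comparison of the output density with the source density for `N = 2 ^ m` letters; the loss
is additive in the number of letters by Bernoulli's inequality. -/
theorem sourceDensity_sub_le (hη : 0 < η) (hσs : 0 < σs) (hv : 0 < recVar σs Δ) (hΔ : 0 < Δ)
    (hfl : flatness η σs Δ ≤ 1) (y : Fin (2 ^ m) → ℝ) :
    sourceDensity m σs y - ∑ x : Bits m r, blockDensity η σs Δ x y ≤
      2 ^ m * flatness η σs Δ * sourceDensity m σs y := by
  have h1 : (1 - flatness η σs Δ) ^ (2 ^ m) * sourceDensity m σs y ≤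
      ∑ x : Bits m r, blockDensity η σs Δ x y := by
    rw [sum_blockDensity, sourceDensity]
    have : (1 - flatness η σs Δ) ^ (2 ^ m) = ∏ _i : Fin (2 ^ m), (1 - flatness η σs Δ) := by simp
    rw [this, ← Finset.prod_mul_distrib]
    refine Finset.prod_le_prod (fun i _ => mul_nonneg (by linarith)
      (gaussianPDFReal_nonneg _ _ _)) fun i _ => ?_
    rw [sum_letterDensity hη hv hΔ]
    exact one_sub_flatness_mul_le hη hσs hv hΔ (y i)
  have h2 : 1 - 2 ^ m * flatness η σs Δ ≤ (1 - flatness η σs Δ) ^ (2 ^ m) := by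
    have := one_add_mul_le_pow (a := -flatness η σs Δ) (by linarith) (2 ^ m)
    push_cast at this
    rw [← sub_eq_add_neg] at this
    linarith
  have h3 := mul_le_mul_of_nonneg_right h2 (sourceDensity_nonneg (σs := σs) y)
  linarith

/-- The expected distortion of the quantizer at a given source realization is that of the test
channel, up to the deviation of the output density and the change caused by the frozen bits. -/
theorem distortion_pointwise_le (hη : 0 < η) (hσs : 0 < σs) (hv : 0 < recVar σs Δ) (hΔ : 0 < Δ)
    (hfl : flatness η σs Δ ≤ 1) (β : ℝ) [∀ ℓ : Fin r,
      DecidablePred (· ∈ infoSet (m := m) η σs Δ β ℓ)] (y : Fin (2 ^ m) → ℝ) :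
    sourceDensity m σs y * ∑ u : Bits m r,
        meanQuantizerProb η σs Δ β u y * distortion σs Δ (reconstruct η σs Δ u y, y) ≤
      (∑ i, ∑ x : Bits m r,
        cellError η σs Δ (fun ℓ => x ℓ i) (y i) * blockDensity η σs Δ x y) +
      2 ^ m * ((2 ^ r * η) ^ 2 / 4) * (2 ^ m * flatness η σs Δ * sourceDensity m σs y) +
      2 ^ m * ((2 ^ r * η) ^ 2 / 4) *
        ∑ ℓ : Fin r, ∑ i with i ∉ infoSet η σs Δ β ℓ, ∑ s : Past m r ℓ i,
          |bitDensity η σs Δ ℓ i 0 s y - bitDensity η σs Δ ℓ i 1 s y| := by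
  set K : ℝ := 2 ^ m * ((2 ^ r * η) ^ 2 / 4) with hK
  have hK0 : 0 ≤ K := by positivity
  set g := sourceDensity m σs y with hg
  set f := ∑ x : Bits m r, blockDensity η σs Δ x y with hf
  set D : Bits m r → ℝ := fun u => distortion σs Δ (reconstruct η σs Δ u y, y) with hD
  set q : Bits m r → ℝ := fun u => meanQuantizerProb η σs Δ β u y with hq
  set p : Bits m r → ℝ := fun u => blockDensity η σs Δ (transform u) y with hp
  have hD0 : ∀ u, 0 ≤ D u := fun u => distortion_nonneg _
  have hDK : ∀ u, D u ≤ K := fun u => by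
    simp only [hD]
    rw [distortion_reconstruct]
    refine (Finset.sum_le_sum fun i _ => cellError_le hη _ _).trans (le_of_eq ?_)
    simp [hK]
  have hq0 : ∀ u, 0 ≤ q u := meanQuantizerProb_nonneg hη hv hΔ β (y := y)
  have hq1 : ∑ u, q u = 1 := sum_meanQuantizerProb hη hv hΔ β y
  have hgf : g - f ≤ 2 ^ m * flatness η σs Δ * g := sourceDensity_sub_le hη hσs hv hΔ hfl y
  have hrhs : 0 ≤ 2 ^ m * flatness η σs Δ * g :=
    mul_nonneg (mul_nonneg (by positivity) (flatness_nonneg hη hσs hv hΔ))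
      (sourceDensity_nonneg y)
  have htv : ∑ u, |f * q u - p u| ≤ _ :=
    sum_abs_quantizer_sub_le η σs Δ β fun x => blockDensity_pos hη hv hΔ x y
  have hP : ∑ u, p u * D u = ∑ i, ∑ x : Bits m r,
      cellError η σs Δ (fun ℓ => x ℓ i) (y i) * blockDensity η σs Δ x y := by
    rw [Finset.sum_comm]
    let E : Bits m r ≃ Bits m r := Function.Involutive.toPerm transform transform_transform
    rw [← Equiv.sum_comp E (fun x : Bits m r => ∑ i, cellError η σs Δ (fun ℓ => x ℓ i) (y i) *
      blockDensity η σs Δ x y)]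
    refine Finset.sum_congr rfl fun u _ => ?_
    rw [← Finset.sum_mul, mul_comm]
    rfl
  calc g * ∑ u, q u * D u = ∑ u, p u * D u + (g - f) * ∑ u, q u * D u
        + ∑ u, (f * q u - p u) * D u := by
        rw [Finset.mul_sum, Finset.mul_sum, ← Finset.sum_add_distrib, ← Finset.sum_add_distrib]
        exact Finset.sum_congr rfl fun u _ => by ring
    _ ≤ ∑ u, p u * D u + (2 ^ m * flatness η σs Δ * g) * K + K * ∑ u, |f * q u - p u| := by
        have h1 : 0 ≤ ∑ u, q u * D u :=
          Finset.sum_nonneg fun u _ => mul_nonneg (hq0 u) (hD0 u)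
        have h2 : ∑ u, q u * D u ≤ K := by
          calc ∑ u, q u * D u ≤ ∑ u, q u * K :=
                Finset.sum_le_sum fun u _ => mul_le_mul_of_nonneg_left (hDK u) (hq0 u)
            _ = K := by rw [← Finset.sum_mul, hq1, one_mul]
        refine add_le_add (add_le_add le_rfl ?_) ?_
        · exact mul_le_mul hgf h2 h1 hrhs
        · rw [Finset.mul_sum]
          refine Finset.sum_le_sum fun u _ => ?_
          calc (f * q u - p u) * D u ≤ |f * q u - p u| * D u :=
                mul_le_mul_of_nonneg_right (le_abs_self _) (hD0 u)
            _ ≤ |f * q u - p u| * K := mul_le_mul_of_nonneg_left (hDK u) (abs_nonneg _)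
            _ = _ := mul_comm _ _
    _ ≤ _ := by
        rw [hP, mul_comm _ K]
        gcongr

theorem integral_sourceDensity (hσs : 0 < σs) :
    Integrable (sourceDensity m σs) ∧ ∫ y, sourceDensity m σs y = 1 := by
  have hne : (σs ^ 2).toNNReal ≠ 0 := by simpa using hσs.ne'
  refine ⟨Integrable.fintype_prod fun _ => integrable_gaussianPDFReal _ _, ?_⟩
  simp only [sourceDensity]
  rw [integral_fintype_prod_volume_eq_prod
    (f := fun _ : Fin (2 ^ m) => gaussianPDFReal 0 (σs ^ 2).toNNReal)]
  simp [integral_gaussianPDFReal_eq_one _ hne]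

/-- The distortion bound for a given block length. The three summands come from the test channel,
from the deviation of its output density, and from the frozen bits, of which there are at most
`r * 2 ^ m`; the factor `2 ^ m * ((2 ^ r * η) ^ 2 / 4)` bounds the distortion. -/
theorem lintegral_distortion_le (hη : 0 < η) (hσs : 0 < σs) (hv : 0 < recVar σs Δ) (hΔ : 0 < Δ)
    (hfl : flatness η σs Δ ≤ 1) (β : ℝ) :
    ∫⁻ p, ENNReal.ofReal (distortion σs Δ p) ∂(jointLaw m r η σs Δ β) ≤
      ENNReal.ofReal (2 ^ m * mmseVar σs Δ +
        2 ^ m * ((2 ^ r * η) ^ 2 / 4) * (2 ^ m * flatness η σs Δ) +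
        2 ^ m * ((2 ^ r * η) ^ 2 / 4) *
          (r * (2 ^ m * √(2 * (2 : ℝ) ^ (-((2 : ℝ) ^ m) ^ β))))) := by
  classical
  set K : ℝ := 2 ^ m * ((2 ^ r * η) ^ 2 / 4) with hK
  have hK0 : 0 ≤ K := by positivity
  set δ : ℝ := (2 : ℝ) ^ (-((2 : ℝ) ^ m) ^ β) with hδ
  have hδ0 : 0 < δ := by positivity
  set F1 : (Fin (2 ^ m) → ℝ) → ℝ := fun y => ∑ i, ∑ x : Bits m r,
    cellError η σs Δ (fun ℓ => x ℓ i) (y i) * blockDensity η σs Δ x y with hF1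
  set F2 : (Fin (2 ^ m) → ℝ) → ℝ := fun y =>
    K * (2 ^ m * flatness η σs Δ * sourceDensity m σs y) with hF2
  set F3 : (Fin (2 ^ m) → ℝ) → ℝ := fun y =>
    K * ∑ ℓ : Fin r, ∑ i with i ∉ infoSet η σs Δ β ℓ, ∑ s : Past m r ℓ i,
      |bitDensity η σs Δ ℓ i 0 s y - bitDensity η σs Δ ℓ i 1 s y| with hF3
  have hfl0 := flatness_nonneg hη hσs hv hΔ
  have i1' : ∀ i : Fin (2 ^ m), Integrable fun y : Fin (2 ^ m) → ℝ => ∑ x : Bits m r,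
      cellError η σs Δ (fun ℓ => x ℓ i) (y i) * blockDensity η σs Δ x y := fun i =>
    integrable_finsetSum _ fun x _ => integrable_blockError hη hv hΔ x i
  have i1 : Integrable F1 := integrable_finsetSum _ fun i _ => i1' i
  have i2 : Integrable F2 := ((integral_sourceDensity hσs).1.const_mul _).const_mul _
  have i3' : ∀ (ℓ : Fin r) (i : Fin (2 ^ m)), Integrable fun y => ∑ s : Past m r ℓ i,
      |bitDensity η σs Δ ℓ i 0 s y - bitDensity η σs Δ ℓ i 1 s y| := fun ℓ i =>
    integrable_finsetSum _ fun s _ => integrable_abs_bitDensity hη hv hΔ ℓ i s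
  have i3'' : ∀ ℓ : Fin r, Integrable fun y => ∑ i with i ∉ infoSet η σs Δ β ℓ,
      ∑ s : Past m r ℓ i,
      |bitDensity η σs Δ ℓ i 0 s y - bitDensity η σs Δ ℓ i 1 s y| := fun ℓ =>
    integrable_finsetSum _ fun i _ => i3' ℓ i
  have i3 : Integrable F3 := (integrable_finsetSum _ fun ℓ _ => i3'' ℓ).const_mul _
  have b1 : ∫ y, F1 y ≤ 2 ^ m * mmseVar σs Δ := by
    rw [hF1, integral_finsetSum _ fun i _ => i1' i]
    refine (Finset.sum_le_sum fun i _ => integral_blockError_le hη hσs hv hΔ i).trans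
      (le_of_eq ?_)
    simp
  have b2 : ∫ y, F2 y = K * (2 ^ m * flatness η σs Δ) := by
    rw [hF2, integral_const_mul, integral_const_mul, (integral_sourceDensity hσs).2, mul_one]
  have b3 : ∫ y, F3 y ≤ K * (r * (2 ^ m * √(2 * δ))) := by
    rw [hF3, integral_const_mul, integral_finsetSum _ fun ℓ _ => i3'' ℓ]
    refine mul_le_mul_of_nonneg_left ?_ hK0
    have : ∀ ℓ : Fin r, ∫ y, ∑ i with i ∉ infoSet η σs Δ β ℓ, ∑ s : Past m r ℓ i,
        |bitDensity η σs Δ ℓ i 0 s y - bitDensity η σs Δ ℓ i 1 s y| ≤ 2 ^ m * √(2 * δ) := by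
      intro ℓ
      rw [integral_finsetSum _ fun i _ => i3' ℓ i]
      calc _ ≤ ∑ i : Fin (2 ^ m) with i ∉ infoSet η σs Δ β ℓ, √(2 * δ) := by
            refine Finset.sum_le_sum fun i hi => integral_abs_bitDensity_le hη hv hΔ ℓ i hδ0 ?_
            exact not_lt.1 (Finset.mem_filter.1 hi).2
        _ ≤ ∑ i : Fin (2 ^ m), √(2 * δ) :=
            Finset.sum_le_sum_of_subset_of_nonneg (Finset.filter_subset _ _)
              fun _ _ _ => Real.sqrt_nonneg _
        _ = _ := by simp
    refine (Finset.sum_le_sum fun ℓ _ => this ℓ).trans (le_of_eq ?_)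
    simp
  have n1 : ∀ y, 0 ≤ F1 y := fun y => Finset.sum_nonneg fun i _ => Finset.sum_nonneg fun x _ =>
    mul_nonneg (cellError_nonneg _ _) (blockDensity_pos hη hv hΔ x y).le
  have n2 : ∀ y, 0 ≤ F2 y := fun y => mul_nonneg hK0 (mul_nonneg (by positivity)
    (sourceDensity_nonneg y))
  have n3 : ∀ y, 0 ≤ F3 y := fun y => mul_nonneg hK0 (Finset.sum_nonneg fun _ _ =>
    Finset.sum_nonneg fun _ _ => Finset.sum_nonneg fun _ _ => abs_nonneg _)
  rw [lintegral_distortion_jointLaw hη hσs hv hΔ]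
  calc _ ≤ ∫⁻ y, ENNReal.ofReal (F1 y + F2 y + F3 y) := by
        refine lintegral_mono fun y => ENNReal.ofReal_le_ofReal ?_
        exact distortion_pointwise_le hη hσs hv hΔ hfl β y
    _ = ENNReal.ofReal (∫ y, (F1 y + F2 y + F3 y)) :=
        (ofReal_integral_eq_lintegral_ofReal ((i1.add i2).add i3) (Filter.Eventually.of_forall
          fun y => add_nonneg (add_nonneg (n1 y) (n2 y)) (n3 y))).symm
    _ ≤ _ := by
        refine ENNReal.ofReal_le_ofReal ?_
        have i12 : Integrable fun y => F1 y + F2 y := i1.add i2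
        rw [integral_add i12 i3, integral_add i1 i2, b2]
        gcongr

end Assembly

/-! ### Asymptotics -/

section Asymptotics
open Filter Real

theorem eventually_sq_mul_exp_le {β' γ b : ℝ} (hβ' : 0 < β') (hγ : β' < γ) (hb : 0 < b) (A : ℝ) :
    ∀ᶠ x : ℝ in atTop, A * x ^ 2 * Real.exp (-b * x ^ γ) ≤ (2 : ℝ) ^ (-x ^ β') / 2 := by
  have hγ0 : 0 < γ := hβ'.trans hγ
  have h1 : Tendsto (fun x : ℝ => A * ((x ^ γ) ^ (2 / γ) * Real.exp (-(b / 2) * x ^ γ))) atTop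
      (nhds (A * 0)) :=
    ((tendsto_rpow_mul_exp_neg_mul_atTop_nhds_zero (2 / γ) (b / 2) (by positivity)).comp
      (tendsto_rpow_atTop hγ0)).const_mul A
  rw [mul_zero] at h1
  have h2 := (tendsto_rpow_atTop (sub_pos.2 hγ)).eventually_ge_atTop (2 * Real.log 2 / b)
  filter_upwards [h1.eventually_le_const (show (0 : ℝ) < 1 / 2 by norm_num), h2,
    eventually_gt_atTop 0] with x h1 h2 hx
  have e1 : (x ^ γ) ^ (2 / γ) = x ^ 2 := by
    rw [← rpow_mul hx.le, mul_div_cancel₀ _ hγ0.ne']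
    norm_cast
  have e2 : x ^ γ = x ^ β' * x ^ (γ - β') := by
    rw [← rpow_add hx]; congr 1; ring
  have hpos : 0 < x ^ β' := rpow_pos_of_pos hx _
  have h3 : Real.log 2 * x ^ β' ≤ b / 2 * x ^ γ := by
    rw [e2]
    rw [div_le_iff₀ hb] at h2
    nlinarith
  have e3 : (2 : ℝ) ^ (-x ^ β') = Real.exp (-(Real.log 2 * x ^ β')) := by
    rw [rpow_def_of_pos two_pos, mul_neg]
  rw [e1] at h1
  have h4 : Real.exp (-(b / 2) * x ^ γ) ≤ Real.exp (-(Real.log 2 * x ^ β')) :=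
    Real.exp_le_exp.2 (by linarith)
  calc A * x ^ 2 * Real.exp (-b * x ^ γ)
      = (A * (x ^ 2 * Real.exp (-(b / 2) * x ^ γ))) * Real.exp (-(b / 2) * x ^ γ) := by
        rw [show -b * x ^ γ = -(b / 2) * x ^ γ + -(b / 2) * x ^ γ by ring, Real.exp_add]
        ring
    _ ≤ 1 / 2 * Real.exp (-(b / 2) * x ^ γ) :=
        mul_le_mul_of_nonneg_right h1 (Real.exp_pos _).le
    _ ≤ 1 / 2 * Real.exp (-(Real.log 2 * x ^ β')) := by gcongr
    _ = _ := by rw [e3]; ring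

/-- When `1 / η ^ 2` grows at least like `x`, the flatness factor decays exponentially in `x`. -/
theorem flatness_le {η σs Δ c x : ℝ} (hσs : 0 < σs) (hΔ : 0 < Δ) (hv : 0 < recVar σs Δ)
    (hx : 1 ≤ 2 * π * mmseVar σs Δ * (c * x)) (h : c * x ≤ 1 / η ^ 2) :
    flatness η σs Δ ≤ 2 * (Real.exp π * (theta 1 - 1)) *
      Real.exp (-(2 * π ^ 2 * mmseVar σs Δ * c) * x) := by
  have hm : 0 < mmseVar σs Δ := by rw [mmseVar]; positivity
  have hmv : mmseVar σs Δ ≤ recVar σs Δ := by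
    rw [mmseVar, div_le_iff₀ (by positivity)]
    exact mul_le_mul_of_nonneg_left (by rw [← recVar_add (Δ := Δ)]; linarith) hv.le
  set t := 2 * π * mmseVar σs Δ / η ^ 2 with ht
  have hxt : 2 * π * mmseVar σs Δ * (c * x) ≤ t := by
    rw [ht, div_eq_mul_one_div]
    gcongr
  have ht1 : 1 ≤ t := hx.trans hxt
  have h1 : theta (2 * π * recVar σs Δ / η ^ 2) ≤ theta t := by
    refine theta_antitone (by linarith) ?_
    rw [ht]
    gcongr
  have h2 := theta_sub_one_le ht1
  have h0 : 0 ≤ theta 1 - 1 := sub_nonneg.2 (one_le_theta one_pos)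
  have h3 : Real.exp (-π * (t - 1)) ≤
      Real.exp π * Real.exp (-(2 * π ^ 2 * mmseVar σs Δ * c) * x) := by
    rw [← Real.exp_add]
    apply Real.exp_le_exp.2
    nlinarith [pi_pos]
  have h4 := mul_le_mul_of_nonneg_right h3 h0
  rw [flatness]
  linarith

theorem exists_threshold {σs Δ β β' c : ℝ} (C : ℝ) (hσs : 0 < σs) (hΔ : 0 < Δ)
    (hv : 0 < recVar σs Δ) (hβ : β < 1 / 2) (hβ' : 0 < β') (hββ' : β' < β) (hc : 0 < c) :
    ∃ N₀ : ℕ, ∀ (m r : ℕ) (η : ℝ), N₀ ≤ 2 ^ m → 0 < η → c * (2 : ℝ) ^ m ≤ 1 / η ^ 2 →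
      1 / η ^ 2 ≤ C * (2 : ℝ) ^ m → 2 ^ r * η = √((2 : ℝ) ^ m) →
      flatness η σs Δ ≤ 1 ∧
      2 ^ m * flatness η σs Δ / 8 + 2 ^ m * (r * √(2 * (2 : ℝ) ^ (-((2 : ℝ) ^ m) ^ β))) / 8 ≤
        (2 : ℝ) ^ (-((2 : ℝ) ^ m) ^ β') := by
  have hm : 0 < mmseVar σs Δ := by rw [mmseVar]; positivity
  set A := 2 * (Real.exp π * (theta 1 - 1)) with hA
  have hA0 : 0 ≤ A := by
    have : 0 ≤ theta 1 - 1 := sub_nonneg.2 (one_le_theta one_pos)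
    positivity
  set a := 2 * π ^ 2 * mmseVar σs Δ * c with ha
  set D := max C 1 with hD
  have hD1 : 1 ≤ D := le_max_right _ _
  have ev1 := eventually_sq_mul_exp_le hβ' (show β' < 1 by linarith)
    (show 0 < a by positivity) A
  have ev2 := eventually_sq_mul_exp_le hβ' hββ'
    (show 0 < Real.log 2 / 2 by have := Real.log_pos one_lt_two; positivity) D
  have ev3 := (tendsto_id.const_mul_atTop
    (show 0 < 2 * π * mmseVar σs Δ * c by positivity)).eventually_ge_atTop (1 : ℝ)
  obtain ⟨x₀, hx₀⟩ := eventually_atTop.1 (ev1.and (ev2.and (ev3.and (eventually_ge_atTop 1))))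
  refine ⟨⌈x₀⌉₊, fun m r η hN hη h1 h2 h3 => ?_⟩
  have hN' : x₀ ≤ (2 : ℝ) ^ m := (Nat.le_ceil x₀).trans (by exact_mod_cast hN)
  obtain ⟨f1, f2, f3, hx1⟩ := hx₀ _ hN'
  set x : ℝ := (2 : ℝ) ^ m with hx
  rw [rpow_one] at f1
  have hfl : flatness η σs Δ ≤ A * Real.exp (-a * x) :=
    flatness_le hσs hΔ hv (by simp only [id] at f3; linarith) h1
  have hE := Real.exp_pos (-a * x)
  have hx2 : x ≤ x ^ 2 := by nlinarith
  have hxA : A * Real.exp (-a * x) ≤ A * x ^ 2 * Real.exp (-a * x) := by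
    have : A * Real.exp (-a * x) * 1 ≤ A * Real.exp (-a * x) * x ^ 2 := by gcongr; linarith
    linarith
  have htwo : (2 : ℝ) ^ (-x ^ β') ≤ 1 :=
    rpow_le_one_of_one_le_of_nonpos one_le_two (neg_nonpos.2 (by positivity))
  refine ⟨by linarith, ?_⟩
  have g1 : x * flatness η σs Δ ≤ A * x ^ 2 * Real.exp (-a * x) := by
    calc x * flatness η σs Δ ≤ x ^ 2 * (A * Real.exp (-a * x)) :=
          (mul_le_mul_of_nonneg_left hfl (by linarith)).trans (by gcongr)
      _ = _ := by ring
  -- The number of levels is at most `2 ^ r = √N / η`, which is of order `N`.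
  have hr : (r : ℝ) ≤ D * x := by
    have hr2 : (r : ℝ) ≤ 2 ^ r := by exact_mod_cast Nat.lt_two_pow_self.le
    have hsq : ((2 : ℝ) ^ r) ^ 2 = x * (1 / η ^ 2) := by
      have : (2 ^ r * η) ^ 2 = x := by rw [h3, sq_sqrt (by positivity)]
      rw [← this]
      field_simp
    have hCD : C ≤ D := le_max_left _ _
    have : ((2 : ℝ) ^ r) ^ 2 ≤ (D * x) ^ 2 := by
      rw [hsq]
      calc x * (1 / η ^ 2) ≤ x * (D * x) := by
            gcongr
            exact h2.trans (by gcongr)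
        _ = 1 * D * x ^ 2 := by ring
        _ ≤ D * D * x ^ 2 := by gcongr
        _ = _ := by ring
    exact hr2.trans (le_of_sq_le_sq this (by positivity))
  have hsqrt : √(2 * (2 : ℝ) ^ (-x ^ β)) ≤ 2 * Real.exp (-(Real.log 2 / 2) * x ^ β) := by
    rw [sqrt_le_left (by positivity), mul_pow, ← Real.exp_nat_mul, rpow_def_of_pos two_pos]
    have : ((2 : ℕ) : ℝ) * (-(Real.log 2 / 2) * x ^ β) = Real.log 2 * -x ^ β := by
      push_cast; ring
    rw [this]
    have := Real.exp_pos (Real.log 2 * -x ^ β)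
    linarith
  have g2 : x * (r * √(2 * (2 : ℝ) ^ (-x ^ β))) ≤
      2 * (D * x ^ 2 * Real.exp (-(Real.log 2 / 2) * x ^ β)) := by
    calc x * (r * √(2 * (2 : ℝ) ^ (-x ^ β)))
        ≤ x * (D * x * (2 * Real.exp (-(Real.log 2 / 2) * x ^ β))) := by gcongr
      _ = _ := by ring
  have hpos : (0 : ℝ) < (2 : ℝ) ^ (-x ^ β') := by positivity
  linarith

end Asymptotics

end PolarLattice

end

theorem mainTheorem3 (σs Δ β β' c C : ℝ) (hσs : 0 < σs) (hΔ : 0 < Δ) (hΔs : Δ < σs ^ 2)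
    (hβ : β < 1 / 2) (hβ' : 0 < β') (hββ' : β' < β) (hc : 0 < c) :
    ∃ N₀ : ℕ, ∀ (m r : ℕ) (η : ℝ), N₀ ≤ 2 ^ m → 0 < η →
      c * (2 : ℝ) ^ m ≤ 1 / η ^ 2 → 1 / η ^ 2 ≤ C * (2 : ℝ) ^ m →
      2 ^ r * η = √((2 : ℝ) ^ m) →
      Integrable (PolarLattice.distortion σs Δ) (PolarLattice.jointLaw m r η σs Δ β) ∧
      1 / (2 : ℝ) ^ m *
          ∫ p, PolarLattice.distortion σs Δ p ∂(PolarLattice.jointLaw m r η σs Δ β) ≤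
        PolarLattice.mmseVar σs Δ + 2 * (2 : ℝ) ^ m * (2 : ℝ) ^ (-((2 : ℝ) ^ m) ^ β') := by
  have hv : 0 < PolarLattice.recVar σs Δ := by rw [PolarLattice.recVar]; linarith
  have hm : 0 < PolarLattice.mmseVar σs Δ := by rw [PolarLattice.mmseVar]; positivity
  obtain ⟨N₀, hN₀⟩ := PolarLattice.exists_threshold C hσs hΔ hv hβ hβ' hββ' hc
  refine ⟨N₀, fun m r η hN hη h1 h2 h3 => ?_⟩
  obtain ⟨hfl, hbound⟩ := hN₀ m r η hN hη h1 h2 h3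
  have hfl0 := PolarLattice.flatness_nonneg hη hσs hv hΔ
  have hle := PolarLattice.lintegral_distortion_le (m := m) (r := r) hη hσs hv hΔ hfl β
  have hsq : (2 ^ r * η) ^ 2 = (2 : ℝ) ^ m := by rw [h3, Real.sq_sqrt (by positivity)]
  rw [hsq] at hle
  have hmeas := (PolarLattice.measurable_distortion (m := m) (σs := σs) (Δ := Δ))
  have hnn : ∀ p, 0 ≤ PolarLattice.distortion (m := m) σs Δ p := PolarLattice.distortion_nonneg
  have hint : Integrable (PolarLattice.distortion σs Δ) (PolarLattice.jointLaw m r η σs Δ β) := by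
    refine ⟨hmeas.aestronglyMeasurable, ?_⟩
    rw [hasFiniteIntegral_iff_ofReal (Filter.Eventually.of_forall hnn)]
    exact hle.trans_lt ENNReal.ofReal_lt_top
  refine ⟨hint, ?_⟩
  rw [← ofReal_integral_eq_lintegral_ofReal hint (Filter.Eventually.of_forall hnn),
    ENNReal.ofReal_le_ofReal_iff (by positivity)] at hle
  have hx : (0 : ℝ) < (2 : ℝ) ^ m := by positivity
  generalize √(2 * (2 : ℝ) ^ (-((2 : ℝ) ^ m) ^ β)) = S at *
  generalize (2 : ℝ) ^ (-((2 : ℝ) ^ m) ^ β') = T at *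
  generalize (2 : ℝ) ^ m = x at *
  rw [one_div, inv_mul_le_iff₀ hx]
  refine hle.trans ?_
  have h4 := mul_le_mul_of_nonneg_left hbound (show 0 ≤ 2 * x * x by positivity)
  calc _ = x * PolarLattice.mmseVar σs Δ +
        2 * x * x * (x * PolarLattice.flatness η σs Δ / 8 + x * (r * S) / 8) := by ring
    _ ≤ x * PolarLattice.mmseVar σs Δ + 2 * x * x * T := by linarith
    _ = _ := by ring
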